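/- Let $N\ge 1$, $\varepsilon>0$, $A_k\in\mathbb R^{n\times n}$ and $B_k\in\mathbb R^{n\times m}$ ($0\le k\le N-1$) with every $A_k$ invertible, $\bar\mu_0,\bar\mu_N\in\mathbb R^n$, and $\bar\Sigma_0,\bar\Sigma_N\succ0$. Put $\Phi(k,l)=A_{k-1}\cdots A_l$ for $k>l$, $\Phi(k,k)=I$, $\Phi(k,l)=A_k^{-1}\cdots A_{l-1}^{-1}$ for $k<l$, and for $k_0<k_1$ $$G_r(k_1,k_0)=\sum_{k=k_0}^{k_1-1}\Phi(k_1,k+1)B_kB_k^\top\Phi(k_1,k+1)^\top,\qquad G_c(k_1,k_0)=\sum_{k=k_0}^{k_1-1}\Phi(k_0,k+1)B_kB_k^\top\Phi(k_0,k+1)^\top .$$ Assume that there is $k_r\in\{1,\dots,N\}$ such that $G_r(k,0)$ is invertible for $k_r\le k\le N$ and $G_r(N,k)$ is invertible for $0\le k\le k_r-1$. Let $G_c=G_c(N,0)$, $$S_0=\tfrac1\varepsilon G_c^{-1/2}\bar\Sigma_0G_c^{-1/2},\qquad S_N=\tfrac1\varepsilon G_c^{-1/2}\Phi(0,N)\bar\Sigma_N\Phi(0,N)^\top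 G_c^{-1/2},$$ and assume that both matrices $\mathcal F=S_0+\tfrac12I-\bigl(S_0^{1/2}S_NS_0^{1/2}+\tfrac14I\bigr)^{1/2}$ and $\mathcal B=-S_0+\tfrac12I+\bigl(S_0^{1/2}S_NS_0^{1/2}+\tfrac14I\bigr)^{1/2}$ are invertible. Let $Q_0=G_c^{1/2}S_0^{1/2}\mathcal F^{-1}S_0^{1/2}G_c^{1/2}$ and $Q_{k+1}=A_kQ_kA_k^\top-B_kB_k^\top$ for $0\le k\le N-1$. Consider the density control problem: over all stochastic policies $\pi=\{\pi_k(u|x)\}_{k=0}^{N-1}$ (for every $x\in\mathbb R^n$, $\pi_k(\cdot|x)$ is a probability density on $\mathbb R^m$, jointly measurable in $(x,u)$), minimize $$\mathbb E\Bigl[\sum_{k=0}^{N-1}\bigl(\tfrac12\|u_k\|^2-\varepsilon H(\pi_k(\cdot|x_k))\bigr)\Bigr],\qquad H(p)=-\int_{\mathbb R^m}p\log p,$$ subject to $x_{k+1}=A_kx_k+B_ku_k$, $u_k\sim\pi_k(\cdot|x)$ given $x_k=x$, $x_0\sim\mathcal N(\bar\mu_0,\bar\Sigma_0)$, $x_N\sim\mathcal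 N(\bar\mu_N,\bar\Sigma_N)$; the cost is regarded as $+\infty$ when $\mathbb E\sum_k\|u_k\|^2=\infty$. Then $Q_k$ is invertible for $0\le k\le N$, $I+B_k^\top Q_{k+1}^{-1}B_k\succ0$ for $0\le k\le N-1$, and the problem has a unique optimal policy, with finite cost (unique up to equality of the densities for Lebesgue-almost every $x$ and $u$), namely $$\pi_k^*(\cdot|x)=\mathcal N\Bigl(-(I+B_k^\top Q_{k+1}^{-1}B_k)^{-1}B_k^\top Q_{k+1}^{-1}A_k(x-\mu_k^*)+\bar u_k^*,\ \varepsilon(I+B_k^\top Q_{k+1}^{-1}B_k)^{-1}\Bigr),$$ where $$\bar u_k^*=B_k^\top\Phi(N,k+1)^\top G_r(N,0)^{-1}(\bar\mu_N-\Phi(N,0)\bar\mu_0),\qquad \mu_k^*=\Phi(k,0)\bar\mu_0+\sum_{s=0}^{k-1}\Phi(k,s+1)B_s\bar u_s^* .$$ Moreover $\{\bar u_k^*\}$ is the unique minimizer of $\sum_{k=0}^{N-1}\frac12\|\bar u_k\|^2$ among the inputs that steer $\mu_{k+1}=A_k\mu_k+B_k\bar u_k$ from $\mu_0=\bar\mu_0$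 to $\mu_N=\bar\mu_N$, and $\{\mu_k^*\}$ is the corresponding trajectory. -/

import Mathlib

open MeasureTheory ProbabilityTheory
open scoped Matrix MatrixOrder ENNReal

noncomputable section

namespace DensityControl

/-- The Euclidean space `ℝⁿ`. -/
abbrev Vec (n : ℕ) : Type := EuclideanSpace ℝ (Fin n)

/-- Real `p × q` matrices. -/
abbrev Mat (p q : ℕ) : Type := Matrix (Fin p) (Fin q) ℝ

/-- Matrix-vector product on Euclidean spaces. -/
def mulV {p q : ℕ} (M : Mat p q) (v : Vec q) : Vec p := WithLp.toLp 2 (M *ᵥ v.ofLp)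

/-! ### State transition matrix, Gramians -/

/-- `fwd A l j = A_{l+j-1} ⋯ A_{l+1} A_l`. -/
def fwd {n : ℕ} (A : ℕ → Mat n n) (l : ℕ) : ℕ → Mat n n
  | 0 => 1
  | j + 1 => A (l + j) * fwd A l j

/-- `bwd A k j = A_k⁻¹ A_{k+1}⁻¹ ⋯ A_{k+j-1}⁻¹`. -/
def bwd {n : ℕ} (A : ℕ → Mat n n) (k : ℕ) : ℕ → Mat n n
  | 0 => 1
  | j + 1 => bwd A k j * (A (k + j))⁻¹

/-- The state-transition matrix `Φ(k, l)`: `A_{k-1} ⋯ A_l` for `k > l`, the identity for `k = l`,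
and `A_k⁻¹ ⋯ A_{l-1}⁻¹` for `k < l`. -/
def Phi {n : ℕ} (A : ℕ → Mat n n) (k l : ℕ) : Mat n n :=
  if l ≤ k then fwd A l (k - l) else bwd A k (l - k)

/-- The reachability Gramian
`G_r(k₁, k₀) = ∑_{k₀ ≤ k < k₁} Φ(k₁, k+1) B_k B_kᵀ Φ(k₁, k+1)ᵀ`. -/
def gramR {n m : ℕ} (A : ℕ → Mat n n) (B : ℕ → Mat n m) (k₁ k₀ : ℕ) : Mat n n :=
  ∑ k ∈ Finset.Ico k₀ k₁, Phi A k₁ (k + 1) * B k * (B k)ᵀ * (Phi A k₁ (k + 1))ᵀ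

/-- The controllability Gramian
`G_c(k₁, k₀) = ∑_{k₀ ≤ k < k₁} Φ(k₀, k+1) B_k B_kᵀ Φ(k₀, k+1)ᵀ`. -/
def gramC {n m : ℕ} (A : ℕ → Mat n n) (B : ℕ → Mat n m) (k₁ k₀ : ℕ) : Mat n n :=
  ∑ k ∈ Finset.Ico k₀ k₁, Phi A k₀ (k + 1) * B k * (B k)ᵀ * (Phi A k₀ (k + 1))ᵀ

/-! ### The data of the Lyapunov equation -/

/-- The positive semidefinite square root of a positive semidefinite matrix. -/
def msqrt {n : ℕ} (M : Mat n n) : Mat n n := CFC.sqrt M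

/-- `S₀ = ε⁻¹ G_c(N,0)^{-1/2} Σ₀ G_c(N,0)^{-1/2}`. -/
def S₀ {n m : ℕ} (N : ℕ) (A : ℕ → Mat n n) (B : ℕ → Mat n m) (ε : ℝ) (Sig₀ : Mat n n) : Mat n n :=
  (1 / ε) • ((msqrt (gramC A B N 0))⁻¹ * Sig₀ * (msqrt (gramC A B N 0))⁻¹)

/-- `S_N = ε⁻¹ G_c(N,0)^{-1/2} Φ(0,N) Σ_N Φ(0,N)ᵀ G_c(N,0)^{-1/2}`. -/
def S_N {n m : ℕ} (N : ℕ) (A : ℕ → Mat n n) (B : ℕ → Mat n m) (ε : ℝ) (SigN : Mat n n) : Mat n n :=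
  (1 / ε) • ((msqrt (gramC A B N 0))⁻¹ * Phi A 0 N * SigN * (Phi A 0 N)ᵀ *
    (msqrt (gramC A B N 0))⁻¹)

/-- `ℱ(S, T) = S + I/2 - (S^{1/2} T S^{1/2} + I/4)^{1/2}`. -/
def calF {n : ℕ} (S T : Mat n n) : Mat n n :=
  S + (1 / 2 : ℝ) • 1 - msqrt (msqrt S * T * msqrt S + (1 / 4 : ℝ) • 1)

/-- `ℬ(S, T) = -S + I/2 + (S^{1/2} T S^{1/2} + I/4)^{1/2}`. -/
def calB {n : ℕ} (S T : Mat n n) : Mat n n :=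
  -S + (1 / 2 : ℝ) • 1 + msqrt (msqrt S * T * msqrt S + (1 / 4 : ℝ) • 1)

/-- The initial value
`Q_{-,0} = G_c^{1/2} S₀^{1/2} (S₀ + I/2 - (S₀^{1/2} S_N S₀^{1/2} + I/4)^{1/2})⁻¹ S₀^{1/2} G_c^{1/2}`,
with `G_c = G_c(N, 0)`. -/
def Q₀ {n m : ℕ} (N : ℕ) (A : ℕ → Mat n n) (B : ℕ → Mat n m) (ε : ℝ) (Sig₀ SigN : Mat n n) :
    Mat n n :=
  msqrt (gramC A B N 0) * msqrt (S₀ N A B ε Sig₀) *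
    (S₀ N A B ε Sig₀ + (1 / 2 : ℝ) • 1 -
      msqrt (msqrt (S₀ N A B ε Sig₀) * S_N N A B ε SigN * msqrt (S₀ N A B ε Sig₀) +
        (1 / 4 : ℝ) • 1))⁻¹ *
    msqrt (S₀ N A B ε Sig₀) * msqrt (gramC A B N 0)

/-- The solution `Q_{-,k}` of `Q_{k+1} = A_k Q_k A_kᵀ - B_k B_kᵀ` with initial value `Q_{-,0}`. -/
def Qminus {n m : ℕ} (N : ℕ) (A : ℕ → Mat n n) (B : ℕ → Mat n m) (ε : ℝ) (Sig₀ SigN : Mat n n) :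
    ℕ → Mat n n
  | 0 => Q₀ N A B ε Sig₀ SigN
  | k + 1 => A k * Qminus N A B ε Sig₀ SigN k * (A k)ᵀ - B k * (B k)ᵀ

/-! ### Mean steering -/

/-- `ū*_k = B_kᵀ Φ(N, k+1)ᵀ G_r(N,0)⁻¹ (μ_N - Φ(N,0) μ₀)`. -/
def meanInput {n m : ℕ} (N : ℕ) (A : ℕ → Mat n n) (B : ℕ → Mat n m) (mu₀ muN : Vec n) (k : ℕ) :
    Vec m :=
  mulV ((B k)ᵀ * (Phi A N (k + 1))ᵀ * (gramR A B N 0)⁻¹) (muN - mulV (Phi A N 0) mu₀)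

/-- `μ*_k = Φ(k,0) μ₀ + ∑_{s<k} Φ(k, s+1) B_s ū*_s` (which is `μ₀` for `k = 0`). -/
def meanState {n m : ℕ} (N : ℕ) (A : ℕ → Mat n n) (B : ℕ → Mat n m) (mu₀ muN : Vec n) (k : ℕ) :
    Vec n :=
  mulV (Phi A k 0) mu₀ +
    ∑ s ∈ Finset.range k, mulV (Phi A k (s + 1) * B s) (meanInput N A B mu₀ muN s)

/-- The deterministic trajectory of `μ_{k+1} = A_k μ_k + B_k v_k` from `mu₀`. -/
def detState {n m : ℕ} (A : ℕ → Mat n n) (B : ℕ → Mat n m) (mu₀ : Vec n) (v : ℕ → Vec m) :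
    ℕ → Vec n
  | 0 => mu₀
  | k + 1 => mulV (A k) (detState A B mu₀ v k) + mulV (B k) (v k)

/-- `v` (at times `0, …, N-1`) is the unique input of least energy `∑ ‖v_k‖² / 2` that steers
`μ_{k+1} = A_k μ_k + B_k v_k` from `mu₀` at time `0` to `muN` at time `N`. -/
structure IsUniqueMinEnergyInput {n m : ℕ} (N : ℕ) (A : ℕ → Mat n n) (B : ℕ → Mat n m)
    (mu₀ muN : Vec n) (v : ℕ → Vec m) : Prop where
  steers : detState A B mu₀ v N = muN
  le : ∀ w : ℕ → Vec m, detState A B mu₀ w N = muN →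
    ∑ k ∈ Finset.range N, (1 / 2) * ‖v k‖ ^ 2 ≤ ∑ k ∈ Finset.range N, (1 / 2) * ‖w k‖ ^ 2
  unique : ∀ w : ℕ → Vec m, detState A B mu₀ w N = muN →
    ∑ k ∈ Finset.range N, (1 / 2) * ‖w k‖ ^ 2 = ∑ k ∈ Finset.range N, (1 / 2) * ‖v k‖ ^ 2 →
    ∀ k < N, w k = v k

/-! ### Stochastic policies, entropy, cost -/

/-- The density `𝒩(u | a, S)` of the Gaussian law with mean `a` and covariance `S ≻ 0`. -/
def gaussDensity {m : ℕ} (a : Vec m) (S : Mat m m) (u : Vec m) : ℝ :=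
  (Real.sqrt ((2 * Real.pi) ^ m * S.det))⁻¹ *
    Real.exp (-(1 / 2) * ((u - a).ofLp ⬝ᵥ (S⁻¹ *ᵥ (u - a).ofLp)))

/-- Integral of an extended real valued function: integral of the positive part minus integral of
the negative part. -/
def extIntegral {Ω : Type*} [MeasurableSpace Ω] (P : Measure Ω) (f : Ω → EReal) : EReal :=
  ((∫⁻ ω, (f ω).toENNReal ∂P : ℝ≥0∞) : EReal) - ((∫⁻ ω, (-f ω).toENNReal ∂P : ℝ≥0∞) : EReal)

/-- The differential entropy `H(p) = -∫ p(u) log p(u) du` of a density `p` on `ℝᵐ`. -/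
def entropy {m : ℕ} (p : Vec m → ℝ) : EReal :=
  extIntegral volume fun u => ((-(p u * Real.log (p u)) : ℝ) : EReal)

/-- A stochastic policy on `{0, …, N-1}`: for every `k < N` and every state `x`, a probability
density `π k x` on `ℝᵐ`, jointly measurable in state and input. -/
structure IsPolicy {n m : ℕ} (N : ℕ) (π : ℕ → Vec n → Vec m → ℝ) : Prop where
  measurable : ∀ k < N, Measurable fun z : Vec n × Vec m => π k z.1 z.2
  nonneg : ∀ k < N, ∀ x u, 0 ≤ π k x u
  lintegral_eq_one : ∀ k < N, ∀ x, ∫⁻ u, ENNReal.ofReal (π k x u) = 1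

/-- `(x, u)` is a state and control process, on the probability space `(Ω, P)`, of the system
`x_{k+1} = A_k x_k + B_k u_k` under the policy `π`, with initial law `ν₀`: `π k x` is the
conditional density of `u_k` given `x_k = x`, that is, the law of `(x_k, u_k)` is
`law(x_k)(dx) π_k(u | x) du`. -/
structure IsControlled {n m : ℕ} (N : ℕ) (A : ℕ → Mat n n) (B : ℕ → Mat n m)
    (ν₀ : Measure (Vec n)) (π : ℕ → Vec n → Vec m → ℝ)
    {Ω : Type} [MeasurableSpace Ω] (P : Measure Ω)
    (x : ℕ → Ω → Vec n) (u : ℕ → Ω → Vec m) : Prop where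
  measurable_state : ∀ k ≤ N, Measurable (x k)
  measurable_input : ∀ k < N, Measurable (u k)
  initial : P.map (x 0) = ν₀
  system : ∀ k < N, ∀ᵐ ω ∂P, x (k + 1) ω = mulV (A k) (x k ω) + mulV (B k) (u k ω)
  policy : ∀ k < N, P.map (fun ω => (x k ω, u k ω)) =
    ((P.map (x k)).prod volume).withDensity fun z => ENNReal.ofReal (π k z.1 z.2)

open Classical in
/-- The cost `E[∑_{k<N} (‖u_k‖²/2 - ε H(π_k(· | x_k)))]`. It is `+∞` by convention when the
control energy `E[∑_{k<N} ‖u_k‖²]` is infinite (the difference may be indeterminate then). When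
the energy is finite, the entropies have integrable positive parts, so that the expectation is
well defined in `(-∞, +∞]`. -/
def cost {n m : ℕ} (N : ℕ) (ε : ℝ) (π : ℕ → Vec n → Vec m → ℝ)
    {Ω : Type} [MeasurableSpace Ω] (P : Measure Ω)
    (x : ℕ → Ω → Vec n) (u : ℕ → Ω → Vec m) : EReal :=
  if ∑ k ∈ Finset.range N, ∫⁻ ω, ‖u k ω‖ₑ ^ 2 ∂P = ⊤ then ⊤
  else extIntegral P fun ω =>
    ∑ k ∈ Finset.range N,
      ((((1 / 2) * ‖u k ω‖ ^ 2 : ℝ) : EReal) - (ε : EReal) * entropy (π k (x k ω)))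

/-- `πs` is the unique optimal policy of the density control problem: minimize the cost over all
policies whose state process has law `ν₀` at time `0` and law `νN` at time `N`. Uniqueness is
equality of densities for (Lebesgue-)almost every state and input. -/
structure IsUniqueOptimalPolicy {n m : ℕ} (N : ℕ) (A : ℕ → Mat n n) (B : ℕ → Mat n m) (ε : ℝ)
    (ν₀ νN : Measure (Vec n)) (πs : ℕ → Vec n → Vec m → ℝ) : Prop where
  isPolicy : IsPolicy N πs
  /-- the policy can be applied -/
  exists_controlled : ∃ (Ω : Type) (_ : MeasurableSpace Ω) (P : Measure Ω)
    (x : ℕ → Ω → Vec n) (u : ℕ → Ω → Vec m),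
    IsProbabilityMeasure P ∧ IsControlled N A B ν₀ πs P x u
  /-- it is feasible, with finite cost -/
  feasible : ∀ (Ω : Type) [MeasurableSpace Ω] (P : Measure Ω) [IsProbabilityMeasure P]
    (x : ℕ → Ω → Vec n) (u : ℕ → Ω → Vec m), IsControlled N A B ν₀ πs P x u →
    P.map (x N) = νN ∧ cost N ε πs P x u ≠ ⊤ ∧ cost N ε πs P x u ≠ ⊥
  /-- it is optimal among all feasible policies, and the only optimal one -/
  optimal : ∀ (Ω : Type) [MeasurableSpace Ω] (P : Measure Ω) [IsProbabilityMeasure P]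
    (x : ℕ → Ω → Vec n) (u : ℕ → Ω → Vec m), IsControlled N A B ν₀ πs P x u →
    ∀ (π : ℕ → Vec n → Vec m → ℝ), IsPolicy N π →
    ∀ (Ω' : Type) [MeasurableSpace Ω'] (P' : Measure Ω') [IsProbabilityMeasure P']
    (x' : ℕ → Ω' → Vec n) (u' : ℕ → Ω' → Vec m), IsControlled N A B ν₀ π P' x' u' →
    P'.map (x' N) = νN →
    cost N ε πs P x u ≤ cost N ε π P' x' u' ∧
    (cost N ε π P' x' u' = cost N ε πs P x u →
      ∀ k < N, ∀ᵐ y : Vec n, ∀ᵐ v : Vec m, π k y v = πs k y v)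

/-- `I + B_kᵀ Q_{-,k+1}⁻¹ B_k`. -/
def weight {n m : ℕ} (N : ℕ) (A : ℕ → Mat n n) (B : ℕ → Mat n m) (ε : ℝ) (Sig₀ SigN : Mat n n)
    (k : ℕ) : Mat m m :=
  1 + (B k)ᵀ * (Qminus N A B ε Sig₀ SigN (k + 1))⁻¹ * B k

/-- The Gaussian policy
`𝒩(u | -(I + B_kᵀ Q_{-,k+1}⁻¹ B_k)⁻¹ B_kᵀ Q_{-,k+1}⁻¹ A_k (x - μ*_k) + ū*_k,
  ε (I + B_kᵀ Q_{-,k+1}⁻¹ B_k)⁻¹)`. -/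
def optPolicy {n m : ℕ} (N : ℕ) (A : ℕ → Mat n n) (B : ℕ → Mat n m) (ε : ℝ)
    (mu₀ muN : Vec n) (Sig₀ SigN : Mat n n) (k : ℕ) (x : Vec n) (u : Vec m) : ℝ :=
  gaussDensity
    (-mulV ((weight N A B ε Sig₀ SigN k)⁻¹ * (B k)ᵀ *
        (Qminus N A B ε Sig₀ SigN (k + 1))⁻¹ * A k) (x - meanState N A B mu₀ muN k) +
      meanInput N A B mu₀ muN k)
    (ε • (weight N A B ε Sig₀ SigN k)⁻¹) u

end DensityControl

end

open DensityControl

/-! The proof is a verification argument: up to endpoint terms, the cost of a policy is its relative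
entropy to the candidate policy.

Let π* be the Gaussian policy built from Q. Completing the square with the Riccati recursion for
Q_k⁻¹ gives, for all y and v, ½‖v‖² + ε log π*_k(v|y) = c_k + V_k(y) - V_{k+1}(A_k y + B_k v). Here
V_k is a quadratic form in y - μ*_k with matrix Q_k⁻¹, minus a linear term carried by the costate
G_r(N,0)⁻¹(μ_N - Φ(N,0)μ₀) (`stageCost_eq`). Since -εH(p) = ε KL(p‖q) + ε∫ p log q, summing along
trajectories telescopes: every policy of finite energy costs ε ∑ E KL(π_k‖π*_k) plus a constant
depending only on the laws of x_0 and x_N (`cost_eq_relEntropy_add_optimalCost`). So π* is optimal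
once it is feasible. A second optimal policy has zero relative entropy, hence equals π* almost
everywhere for the law of its own state; inductively that law is the nondegenerate Gaussian law of
the π* state, so equality holds Lebesgue-almost everywhere.

Two algebraic facts about Q remain.

No breakdown: pulled back to time 0, Q_k is Q_0 - G_c(k,0). The formula for Q_0 yields G_c⁻¹ - Q_0⁻¹
≻ 0, although Q_0 may be indefinite, and this ordering alone makes Q_0 - H invertible whenever 0 ⪯ H
⪯ G_c and makes the weights positive definite (`isRiccatiSolution_Qminus`).

Feasibility: the closed-loop covariances are Q_k Y_k Q_k + εQ_k with Y_k = A_kᵀ Y_{k+1} A_k. Fitting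
Y_0 to Σ₀, the terminal value is Σ_N because P = (S₀^{1/2} S_N S₀^{1/2} + I/4)^{1/2} - I/2 solves P²
+ P = S₀^{1/2} S_N S₀^{1/2} (`exists_isClosedLoopCovariance`). -/

set_option linter.unusedSectionVars false

/-! ### Matrix inequalities and the one-step Riccati algebra -/

section MatrixLemmas

variable {ι κ : Type*} [Fintype ι] [DecidableEq ι] [Fintype κ] [DecidableEq κ]

theorem dotProduct_mulVec_comm_of_isSymm {M : Matrix ι ι ℝ} (hM : M.IsSymm) (x y : ι → ℝ) :
    x ⬝ᵥ (M *ᵥ y) = y ⬝ᵥ (M *ᵥ x) := by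
  rw [Matrix.dotProduct_mulVec, ← Matrix.mulVec_transpose, hM.eq, dotProduct_comm]

theorem dotProduct_mulVec_transpose (M : Matrix ι κ ℝ) (x : ι → ℝ) (y : κ → ℝ) :
    x ⬝ᵥ (M *ᵥ y) = (Mᵀ *ᵥ x) ⬝ᵥ y := by
  rw [Matrix.dotProduct_mulVec, ← Matrix.mulVec_transpose]

theorem Matrix.PosDef.isSymm {M : Matrix ι ι ℝ} (h : M.PosDef) : M.IsSymm := by
  simpa using h.1

theorem Matrix.PosSemidef.isSymm {M : Matrix ι ι ℝ} (h : M.PosSemidef) : M.IsSymm := by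
  simpa using h.1

theorem Matrix.PosDef.of_mul_eq_one {M K : Matrix ι ι ℝ} (hK : K.PosDef) (h : M * K = 1) :
    M.PosDef := by
  rw [← Matrix.inv_eq_left_inv h]; exact hK.inv

theorem Matrix.PosDef.conj_of_isUnit {M : Matrix ι ι ℝ} (hM : M.PosDef) {T : Matrix ι ι ℝ}
    (hT : IsUnit T) : (T * M * Tᵀ).PosDef := by
  have := hM.mul_mul_conjTranspose_same (B := T) (Matrix.vecMul_injective_of_isUnit hT)
  simpa using this

theorem isUnit_of_mulVec_eq_zero {M : Matrix ι ι ℝ} (h : ∀ y, M *ᵥ y = 0 → y = 0) : IsUnit M := by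
  rw [← Matrix.mulVec_injective_iff_isUnit]
  intro x y hxy
  have := h (x - y) (by rw [Matrix.mulVec_sub]; exact sub_eq_zero.2 hxy)
  exact sub_eq_zero.1 this

/-- The quadratic form of `G⁻¹` at `H y + C v` is at most `yᵀ H y + vᵀ v` when
`H + C Cᵀ ≤ G`. -/
theorem inv_quadratic_le {G H : Matrix ι ι ℝ} {C : Matrix ι κ ℝ} (hG : G.PosDef)
    (hH : H.PosSemidef) (hle : (G - H - C * Cᵀ).PosSemidef) (y : ι → ℝ) (v : κ → ℝ) :
    (H *ᵥ y + C *ᵥ v) ⬝ᵥ (G⁻¹ *ᵥ (H *ᵥ y + C *ᵥ v)) ≤ y ⬝ᵥ (H *ᵥ y) + v ⬝ᵥ v := by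
  set z := H *ᵥ y + C *ᵥ v with hz
  set p := G⁻¹ *ᵥ z with hp
  have hGp : G *ᵥ p = z := by
    rw [hp, Matrix.mulVec_mulVec, Matrix.mul_nonsing_inv _ (Matrix.isUnit_iff_isUnit_det _ |>.1
      hG.isUnit), Matrix.one_mulVec]
  -- The gap between the two sides is (p-y)ᵀH(p-y) + ‖Cᵀp - v‖² + pᵀ(G - H - CCᵀ)p, where p = G⁻¹z;
  -- `h1`, `h2`, `h3` are its three terms.
  have h1 := hH.dotProduct_mulVec_nonneg (p - y)
  have h2 : 0 ≤ (Cᵀ *ᵥ p - v) ⬝ᵥ (Cᵀ *ᵥ p - v) := by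
    simpa using dotProduct_star_self_nonneg (Cᵀ *ᵥ p - v)
  have h3 := hle.dotProduct_mulVec_nonneg p
  have h4 : p ⬝ᵥ z = p ⬝ᵥ (H *ᵥ y) + p ⬝ᵥ (C *ᵥ v) := by rw [hz, dotProduct_add]
  have h5 := dotProduct_mulVec_comm_of_isSymm hH.isSymm p y
  have h6 : p ⬝ᵥ (C *ᵥ v) = (Cᵀ *ᵥ p) ⬝ᵥ v := dotProduct_mulVec_transpose _ _ _
  have h7 : p ⬝ᵥ ((C * Cᵀ) *ᵥ p) = (Cᵀ *ᵥ p) ⬝ᵥ (Cᵀ *ᵥ p) := by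
    rw [← Matrix.mulVec_mulVec, dotProduct_mulVec_transpose]
  have h8 := dotProduct_comm (Cᵀ *ᵥ p) v
  simp only [star_trivial, Matrix.mulVec_sub, Matrix.sub_mulVec, dotProduct_sub, sub_dotProduct,
    hGp] at h1 h2 h3
  rw [dotProduct_comm z p]
  linarith

theorem inv_quadratic_lt {G H M : Matrix ι ι ℝ} {C : Matrix ι κ ℝ} (hG : G.PosDef)
    (hD : (G⁻¹ - M).PosDef)
    (hH : H.PosSemidef) (hle : (G - H - C * Cᵀ).PosSemidef) (y : ι → ℝ) (v : κ → ℝ)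
    (hz : H *ᵥ y + C *ᵥ v ≠ 0) :
    (H *ᵥ y + C *ᵥ v) ⬝ᵥ (M *ᵥ (H *ᵥ y + C *ᵥ v)) < y ⬝ᵥ (H *ᵥ y) + v ⬝ᵥ v := by
  have h1 := inv_quadratic_le hG hH hle y v
  have h2 := hD.dotProduct_mulVec_pos hz
  simp only [star_trivial, Matrix.sub_mulVec, dotProduct_sub] at h2
  linarith

/-- A kernel vector y satisfies Qy = Hy =: z, so zᵀQ⁻¹z = yᵀHy, which contradicts the strict bound
of `inv_quadratic_lt` unless z = 0. No sign of Q is needed. -/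
theorem isUnit_sub_of_inv_lt {G H Q : Matrix ι ι ℝ} (hG : G.PosDef) (hQ : IsUnit Q)
    (hD : (G⁻¹ - Q⁻¹).PosDef) (hH : H.PosSemidef) (hle : (G - H).PosSemidef) :
    IsUnit (Q - H) := by
  refine isUnit_of_mulVec_eq_zero fun y hy => ?_
  have hQy : Q *ᵥ y = H *ᵥ y := by rwa [Matrix.sub_mulVec, sub_eq_zero] at hy
  have hy' : Q⁻¹ *ᵥ (H *ᵥ y) = y := by
    rw [← hQy, Matrix.mulVec_mulVec, Matrix.nonsing_inv_mul _ (Matrix.isUnit_iff_isUnit_det _ |>.1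
      hQ), Matrix.one_mulVec]
  by_contra hne
  have hz : H *ᵥ y ≠ 0 := fun h => hne (by rw [← hy', h, Matrix.mulVec_zero])
  have := inv_quadratic_lt (C := (0 : Matrix ι ι ℝ)) hG hD hH (by simpa using hle) y 0 (by simpa)
  simp only [Matrix.mulVec_zero, add_zero, hy', dotProduct_zero] at this
  rw [dotProduct_comm] at this
  exact lt_irrefl _ this

/-- With y = (Q-H)⁻¹Cv and z = Qy = Hy + Cv, the form at v is vᵀv + yᵀHy - zᵀQ⁻¹z, which
`inv_quadratic_lt` makes positive. If z = 0 then y = 0 and the form is vᵀv. -/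
theorem posDef_one_sub_of_inv_lt {G H Q : Matrix ι ι ℝ} {C : Matrix ι κ ℝ} (hG : G.PosDef)
    (hQ : IsUnit Q) (hQs : Q.IsSymm) (hD : (G⁻¹ - Q⁻¹).PosDef) (hH : H.PosSemidef)
    (hle : (G - H - C * Cᵀ).PosSemidef) :
    (1 - Cᵀ * (Q - H)⁻¹ * C).PosDef := by
  have hCC : (C * Cᵀ).PosSemidef := by simpa using Matrix.posSemidef_self_mul_conjTranspose C
  have hle' : (G - H).PosSemidef := by simpa using hle.add hCC
  have hu := isUnit_sub_of_inv_lt hG hQ hD hH hle'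
  have hs : (Q - H).IsSymm := hQs.sub hH.isSymm
  refine Matrix.PosDef.of_dotProduct_mulVec_pos ?_ fun v hv => ?_
  · rw [Matrix.isHermitian_iff_isSymm, Matrix.IsSymm]
    simp only [Matrix.transpose_sub, Matrix.transpose_one, Matrix.transpose_mul,
      Matrix.transpose_transpose, hs.inv.eq, Matrix.mul_assoc]
  · set y := (Q - H)⁻¹ *ᵥ (C *ᵥ v) with hy
    have h1 : (Q - H) *ᵥ y = C *ᵥ v := by
      rw [hy, Matrix.mulVec_mulVec, Matrix.mul_nonsing_inv _ (Matrix.isUnit_iff_isUnit_det _ |>.1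
        hu), Matrix.one_mulVec]
    have hQy : Q *ᵥ y = H *ᵥ y + C *ᵥ v := by
      rw [← h1, Matrix.sub_mulVec]; abel
    have hy' : Q⁻¹ *ᵥ (H *ᵥ y + C *ᵥ v) = y := by
      rw [← hQy, Matrix.mulVec_mulVec, Matrix.nonsing_inv_mul _
        (Matrix.isUnit_iff_isUnit_det _ |>.1 hQ), Matrix.one_mulVec]
    have hvv : 0 < v ⬝ᵥ v := by simpa using Matrix.dotProduct_star_self_pos_iff.2 hv
    have goal_eq : star v ⬝ᵥ ((1 - Cᵀ * (Q - H)⁻¹ * C) *ᵥ v) = v ⬝ᵥ v - (C *ᵥ v) ⬝ᵥ y := by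
      rw [star_trivial, Matrix.sub_mulVec, Matrix.one_mulVec, dotProduct_sub,
        ← Matrix.mulVec_mulVec, ← Matrix.mulVec_mulVec, dotProduct_mulVec_transpose,
        Matrix.transpose_transpose]
    rw [goal_eq]
    by_cases hz : H *ᵥ y + C *ᵥ v = 0
    · rw [hz, Matrix.mulVec_zero] at hy'
      rw [← hy', dotProduct_zero]; linarith
    · have := inv_quadratic_lt hG hD hH hle y v hz
      rw [hy', add_dotProduct, dotProduct_comm (H *ᵥ y) y] at this
      linarith

/-- The Woodbury identity, resting on Q⁻¹(R - Q)R⁻¹ = Q⁻¹ - R⁻¹. It passes positivity from I -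
CᵀR⁻¹C to the weight I + CᵀQ⁻¹C. -/
theorem one_add_mul_one_sub_woodbury {Q R : Matrix ι ι ℝ} {C : Matrix ι κ ℝ} (hQ : IsUnit Q)
    (hR : IsUnit R) (h : Q = R - C * Cᵀ) :
    (1 + Cᵀ * Q⁻¹ * C) * (1 - Cᵀ * R⁻¹ * C) = 1 := by
  have h1 : Q⁻¹ * Q = 1 := Matrix.nonsing_inv_mul _ (Matrix.isUnit_iff_isUnit_det _ |>.1 hQ)
  have h2 : R * R⁻¹ = 1 := Matrix.mul_nonsing_inv _ (Matrix.isUnit_iff_isUnit_det _ |>.1 hR)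
  have h3 : C * Cᵀ = R - Q := by rw [h]; abel
  have : Q⁻¹ * (C * Cᵀ) * R⁻¹ = Q⁻¹ - R⁻¹ := by
    rw [h3, mul_sub, sub_mul, Matrix.mul_assoc, h2, h1, one_mul, mul_one]
  calc (1 + Cᵀ * Q⁻¹ * C) * (1 - Cᵀ * R⁻¹ * C)
      = 1 + Cᵀ * (Q⁻¹ - R⁻¹ - Q⁻¹ * (C * Cᵀ) * R⁻¹) * C := by
        simp only [Matrix.mul_sub, Matrix.sub_mul, Matrix.add_mul, Matrix.mul_assoc,
          Matrix.one_mul, Matrix.mul_one]; abel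
    _ = 1 := by rw [this]; simp

theorem mul_weight_inv_mul {Q R : Matrix ι ι ℝ} {C : Matrix ι κ ℝ} (hQ : IsUnit Q)
    (hR : IsUnit R) (h : Q = R - C * Cᵀ) :
    C * (1 + Cᵀ * Q⁻¹ * C)⁻¹ * Cᵀ = Q - Q * R⁻¹ * Q := by
  have h1 : R⁻¹ * R = 1 := Matrix.nonsing_inv_mul _ (Matrix.isUnit_iff_isUnit_det _ |>.1 hR)
  have h2 : R * R⁻¹ = 1 := Matrix.mul_nonsing_inv _ (Matrix.isUnit_iff_isUnit_det _ |>.1 hR)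
  have h3 : C * Cᵀ = R - Q := by rw [h]; abel
  rw [Matrix.inv_eq_right_inv (one_add_mul_one_sub_woodbury hQ hR h)]
  calc C * (1 - Cᵀ * R⁻¹ * C) * Cᵀ = C * Cᵀ - (C * Cᵀ) * R⁻¹ * (C * Cᵀ) := by
        simp only [Matrix.mul_sub, Matrix.sub_mul, Matrix.mul_assoc, Matrix.mul_one]
    _ = Q - Q * R⁻¹ * Q := by
        rw [h3]
        simp only [Matrix.mul_sub, Matrix.sub_mul, Matrix.mul_assoc, h1, Matrix.mul_one]
        rw [← Matrix.mul_assoc R, h2, Matrix.one_mul]; abel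

/-- One step of the closed-loop covariance recursion. -/
theorem closedLoop_covariance_step {Q Q' A Y Y' : Matrix ι ι ℝ} {C : Matrix ι κ ℝ} (ε : ℝ)
    (hQ : IsUnit Q) (hA : IsUnit A) (hQ' : IsUnit Q') (hQ's : Q'.IsSymm) (hQs : Q.IsSymm)
    (h : Q' = A * Q * Aᵀ - C * Cᵀ) (hY : Y = Aᵀ * Y' * A) :
    (A - C * ((1 + Cᵀ * Q'⁻¹ * C)⁻¹ * Cᵀ * Q'⁻¹ * A)) * (Q * Y * Q + ε • Q) *
      (A - C * ((1 + Cᵀ * Q'⁻¹ * C)⁻¹ * Cᵀ * Q'⁻¹ * A))ᵀ +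
      C * (ε • (1 + Cᵀ * Q'⁻¹ * C)⁻¹) * Cᵀ = Q' * Y' * Q' + ε • Q' ∧
    IsUnit (A - C * ((1 + Cᵀ * Q'⁻¹ * C)⁻¹ * Cᵀ * Q'⁻¹ * A)) := by
  have hAT : IsUnit Aᵀ := by simpa using hA
  have hR : IsUnit (A * Q * Aᵀ) := (hA.mul hQ).mul hAT
  have dA := Matrix.isUnit_iff_isUnit_det _ |>.1 hA
  have dAT := Matrix.isUnit_iff_isUnit_det _ |>.1 hAT
  have dQ := Matrix.isUnit_iff_isUnit_det _ |>.1 hQ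
  have dQ' := Matrix.isUnit_iff_isUnit_det _ |>.1 hQ'
  have key := mul_weight_inv_mul hQ' hR h
  -- In this factored form the closed-loop matrix sends QYQ + εQ to Q'Y'Q' + εQ'R⁻¹Q' with R = AQAᵀ;
  -- the noise covariance ε(Q' - Q'R⁻¹Q') cancels the excess.
  have hL : A - C * ((1 + Cᵀ * Q'⁻¹ * C)⁻¹ * Cᵀ * Q'⁻¹ * A) = Q' * (Aᵀ)⁻¹ * Q⁻¹ := by
    have : C * ((1 + Cᵀ * Q'⁻¹ * C)⁻¹ * Cᵀ * Q'⁻¹ * A) =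
        (C * (1 + Cᵀ * Q'⁻¹ * C)⁻¹ * Cᵀ) * Q'⁻¹ * A := by simp only [Matrix.mul_assoc]
    rw [this, key, Matrix.mul_inv_rev, Matrix.mul_inv_rev]
    simp only [Matrix.sub_mul, Matrix.mul_assoc]
    rw [Matrix.mul_nonsing_inv_cancel_left _ _ dQ', Matrix.nonsing_inv_mul _ dA]
    simp
  constructor
  · have e : C * (ε • (1 + Cᵀ * Q'⁻¹ * C)⁻¹) * Cᵀ = ε • (Q' - Q' * (A * Q * Aᵀ)⁻¹ * Q') := by
      rw [← key, Matrix.mul_smul, Matrix.smul_mul]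
    rw [e, hL, hY, Matrix.mul_inv_rev, Matrix.mul_inv_rev]
    simp only [Matrix.transpose_mul, Matrix.transpose_nonsing_inv, hQ's.eq, hQs.eq,
      Matrix.transpose_transpose, Matrix.mul_assoc, Matrix.mul_add, Matrix.add_mul,
      Matrix.mul_smul, Matrix.smul_mul, Matrix.nonsing_inv_mul_cancel_left _ _ dQ,
      Matrix.mul_nonsing_inv_cancel_left _ _ dQ, Matrix.nonsing_inv_mul_cancel_left _ _ dAT,
      Matrix.mul_nonsing_inv_cancel_left _ _ dA, smul_sub]
    abel
  · rw [hL]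
    exact (hQ'.mul ((Matrix.isUnit_nonsing_inv_iff).2 hAT)).mul
      ((Matrix.isUnit_nonsing_inv_iff).2 hQ)

/-- One step of the Riccati recursion, in terms of `Q`. -/
theorem riccati_step {Q Q' A : Matrix ι ι ℝ} {C : Matrix ι κ ℝ}
    (hQ : IsUnit Q) (hA : IsUnit A) (hQ' : IsUnit Q')
    (h : Q' = A * Q * Aᵀ - C * Cᵀ) :
    Aᵀ * Q'⁻¹ * A = Q⁻¹ + Aᵀ * Q'⁻¹ * C * (1 + Cᵀ * Q'⁻¹ * C)⁻¹ * Cᵀ * Q'⁻¹ * A := by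
  have hAT : IsUnit Aᵀ := by simpa using hA
  have hR : IsUnit (A * Q * Aᵀ) := (hA.mul hQ).mul hAT
  have dA := Matrix.isUnit_iff_isUnit_det _ |>.1 hA
  have dAT := Matrix.isUnit_iff_isUnit_det _ |>.1 hAT
  have dQ' := Matrix.isUnit_iff_isUnit_det _ |>.1 hQ'
  have key := mul_weight_inv_mul hQ' hR h
  have : Aᵀ * Q'⁻¹ * C * (1 + Cᵀ * Q'⁻¹ * C)⁻¹ * Cᵀ * Q'⁻¹ * A =
      Aᵀ * Q'⁻¹ * (C * (1 + Cᵀ * Q'⁻¹ * C)⁻¹ * Cᵀ) * Q'⁻¹ * A := by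
    simp only [Matrix.mul_assoc]
  rw [this, key, Matrix.mul_inv_rev, Matrix.mul_inv_rev]
  simp only [Matrix.mul_assoc, Matrix.mul_sub, Matrix.sub_mul,
    Matrix.nonsing_inv_mul_cancel_left _ _ dQ', Matrix.mul_nonsing_inv_cancel_left _ _ dQ',
    Matrix.mul_nonsing_inv_cancel_left _ _ dAT, Matrix.nonsing_inv_mul _ dA, Matrix.mul_one]
  abel

/-- Completing the square in v: the coefficient of v is the weight, the minimizer is minus the
feedback gain applied to y, and `riccati_step` identifies the remainder. -/
theorem riccati_completeSquare {Q Q' A : Matrix ι ι ℝ} {C : Matrix ι κ ℝ}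
    (hQ : IsUnit Q) (hA : IsUnit A) (hQ' : IsUnit Q') (hQ's : Q'.IsSymm)
    (h : Q' = A * Q * Aᵀ - C * Cᵀ) (hW : IsUnit (1 + Cᵀ * Q'⁻¹ * C)) (y : ι → ℝ) (v : κ → ℝ) :
    v ⬝ᵥ v + (A *ᵥ y + C *ᵥ v) ⬝ᵥ (Q'⁻¹ *ᵥ (A *ᵥ y + C *ᵥ v)) =
      y ⬝ᵥ (Q⁻¹ *ᵥ y) +
      (v + ((1 + Cᵀ * Q'⁻¹ * C)⁻¹ * Cᵀ * Q'⁻¹ * A) *ᵥ y) ⬝ᵥ ((1 + Cᵀ * Q'⁻¹ * C) *ᵥ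
        (v + ((1 + Cᵀ * Q'⁻¹ * C)⁻¹ * Cᵀ * Q'⁻¹ * A) *ᵥ y)) := by
  set W := 1 + Cᵀ * Q'⁻¹ * C with hWdef
  have dW := Matrix.isUnit_iff_isUnit_det _ |>.1 hW
  have hWs : W.IsSymm := by
    simp [hWdef, Matrix.IsSymm, Matrix.mul_assoc, hQ's.inv.eq]
  have ric := riccati_step hQ hA hQ' h
  rw [← hWdef] at ric
  set k := (W⁻¹ * Cᵀ * Q'⁻¹ * A) *ᵥ y with hk
  have hWk : W *ᵥ k = Cᵀ *ᵥ (Q'⁻¹ *ᵥ (A *ᵥ y)) := by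
    simp only [hk, Matrix.mulVec_mulVec, Matrix.mul_assoc,
      Matrix.mul_nonsing_inv_cancel_left _ _ dW]
  have h1 : v ⬝ᵥ (W *ᵥ v) = v ⬝ᵥ v + (C *ᵥ v) ⬝ᵥ (Q'⁻¹ *ᵥ (C *ᵥ v)) := by
    rw [hWdef, Matrix.add_mulVec, dotProduct_add, Matrix.one_mulVec, ← Matrix.mulVec_mulVec,
      ← Matrix.mulVec_mulVec, dotProduct_mulVec_transpose, Matrix.transpose_transpose]
  have h2 : v ⬝ᵥ (W *ᵥ k) = (C *ᵥ v) ⬝ᵥ (Q'⁻¹ *ᵥ (A *ᵥ y)) := by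
    rw [hWk, dotProduct_mulVec_transpose, Matrix.transpose_transpose]
  have h3 : k ⬝ᵥ (W *ᵥ v) = v ⬝ᵥ (W *ᵥ k) := dotProduct_mulVec_comm_of_isSymm hWs _ _
  have h4 : (A *ᵥ y) ⬝ᵥ (Q'⁻¹ *ᵥ (C *ᵥ v)) = (C *ᵥ v) ⬝ᵥ (Q'⁻¹ *ᵥ (A *ᵥ y)) :=
    dotProduct_mulVec_comm_of_isSymm hQ's.inv _ _
  have h5 : (A *ᵥ y) ⬝ᵥ (Q'⁻¹ *ᵥ (A *ᵥ y)) = y ⬝ᵥ (Q⁻¹ *ᵥ y) + k ⬝ᵥ (W *ᵥ k) := by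
    have e1 : (A *ᵥ y) ⬝ᵥ (Q'⁻¹ *ᵥ (A *ᵥ y)) = y ⬝ᵥ ((Aᵀ * Q'⁻¹ * A) *ᵥ y) := by
      rw [← Matrix.mulVec_mulVec, ← Matrix.mulVec_mulVec, dotProduct_mulVec_transpose Aᵀ,
        Matrix.transpose_transpose]
    have e2 : k ⬝ᵥ (W *ᵥ k) = y ⬝ᵥ ((Aᵀ * Q'⁻¹ * C * W⁻¹ * Cᵀ * Q'⁻¹ * A) *ᵥ y) := by
      rw [hWk, dotProduct_comm, hk, dotProduct_mulVec_transpose, dotProduct_comm]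
      congr 1
      simp only [Matrix.mulVec_mulVec, Matrix.transpose_mul, hQ's.inv.eq, hWs.inv.eq,
        Matrix.transpose_transpose, Matrix.mul_assoc]
    rw [e1, e2, ric, Matrix.add_mulVec, dotProduct_add]
  simp only [Matrix.mulVec_add, dotProduct_add, add_dotProduct]
  rw [h1, h3, h2, h4, h5]
  ring

end MatrixLemmas

/-! ### Positive square roots -/

section SquareRoots

variable {n : ℕ}

theorem msqrt_mul_msqrt {M : Mat n n} (hM : M.PosSemidef) : msqrt M * msqrt M = M :=
  CFC.sqrt_mul_sqrt_self M hM.nonneg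

theorem msqrt_posSemidef (M : Mat n n) : (msqrt M).PosSemidef :=
  Matrix.nonneg_iff_posSemidef.1 (CFC.sqrt_nonneg M)

theorem msqrt_posDef {M : Mat n n} (hM : M.PosDef) : (msqrt M).PosDef := by
  rw [(msqrt_posSemidef M).posDef_iff_isUnit]
  have h := hM.isUnit
  rw [← msqrt_mul_msqrt hM.posSemidef, (Commute.refl (msqrt M)).isUnit_mul_iff] at h
  exact h.1

theorem posDef_half_smul_one : ((1 / 2 : ℝ) • (1 : Mat n n)).PosDef :=
  Matrix.PosDef.one.smul (by norm_num)

/-- Since R² = X + I/4, (R - I/2)(R + I/2) = X in either order. So R - I/2 is the product of the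
commuting positive matrices X and (R + I/2)⁻¹, and it is invertible. -/
theorem posDef_msqrt_sub_half {X : Mat n n} (hX : X.PosDef) :
    (msqrt (X + (1 / 4 : ℝ) • 1) - (1 / 2 : ℝ) • 1).PosDef := by
  have hXq : (X + (1 / 4 : ℝ) • 1).PosSemidef :=
    hX.posSemidef.add (Matrix.PosDef.one.smul (by norm_num)).posSemidef
  set R := msqrt (X + (1 / 4 : ℝ) • 1) with hR
  have hRR : R * R = X + (1 / 4 : ℝ) • 1 := msqrt_mul_msqrt hXq
  have hT : (R + (1 / 2 : ℝ) • 1).PosDef := posDef_half_smul_one.posSemidef_add (msqrt_posSemidef _)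
  set T := R + (1 / 2 : ℝ) • (1 : Mat n n) with hTdef
  have e1 : (R - (1 / 2 : ℝ) • 1) * T = X := by
    simp only [hTdef, mul_add, sub_mul, hRR, Matrix.mul_smul, Matrix.smul_mul, Matrix.mul_one,
      Matrix.one_mul]
    module
  have e2 : T * (R - (1 / 2 : ℝ) • 1) = X := by
    simp only [hTdef, add_mul, mul_sub, hRR, Matrix.mul_smul, Matrix.smul_mul, Matrix.mul_one,
      Matrix.one_mul]
    module
  have dT := (Matrix.isUnit_iff_isUnit_det _).1 hT.isUnit
  have e3 : R - (1 / 2 : ℝ) • 1 = X * T⁻¹ := by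
    rw [← e1, Matrix.mul_nonsing_inv_cancel_right _ _ dT]
  have e4 : R - (1 / 2 : ℝ) • 1 = T⁻¹ * X := by
    rw [← e2, Matrix.nonsing_inv_mul_cancel_left _ _ dT]
  have h0 : 0 ≤ X * T⁻¹ :=
    Commute.mul_nonneg hX.posSemidef.nonneg hT.inv.posSemidef.nonneg (e3.symm.trans e4)
  rw [e3, (Matrix.nonneg_iff_posSemidef.1 h0).posDef_iff_isUnit]
  exact hX.isUnit.mul hT.inv.isUnit

end SquareRoots

/-! ### The initial matrix Q_0, with g = G_c^{1/2}, s = S₀^{1/2}, T = S_N -/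

section InitialMatrix

variable {n : ℕ} {g s R T F : Mat n n}

theorem inv_bridgeInitial (hF : IsUnit F) :
    (g * s * F⁻¹ * s * g)⁻¹ = g⁻¹ * s⁻¹ * F * s⁻¹ * g⁻¹ := by
  have dF := (Matrix.isUnit_iff_isUnit_det _).1 hF
  simp only [Matrix.mul_inv_rev, Matrix.nonsing_inv_nonsing_inv _ dF, Matrix.mul_assoc]

/-- Q_0⁻¹ is the conjugate of F while (g²)⁻¹ is that of s², and s² - F = R - I/2. Together with
`posDef_msqrt_sub_half` this yields G_c⁻¹ - Q_0⁻¹ ≻ 0. -/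
theorem inv_sub_inv_bridgeInitial (hs : IsUnit s) (hF : IsUnit F)
    (hFdef : F = s * s + (1 / 2 : ℝ) • 1 - R) :
    (g * g)⁻¹ - (g * s * F⁻¹ * s * g)⁻¹ =
      (g⁻¹ * s⁻¹) * (R - (1 / 2 : ℝ) • 1) * (s⁻¹ * g⁻¹) := by
  have ds := (Matrix.isUnit_iff_isUnit_det _).1 hs
  have h : R - (1 / 2 : ℝ) • 1 = s * s - F := by rw [hFdef]; abel
  rw [inv_bridgeInitial hF, h, Matrix.mul_inv_rev]
  simp only [Matrix.mul_assoc, Matrix.sub_mul, Matrix.mul_sub,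
    Matrix.mul_nonsing_inv_cancel_left _ _ ds, Matrix.nonsing_inv_mul_cancel_left _ _ ds]

/-- The terminal covariance condition, pulled back to time 0 and divided by ε. With P = R - I/2, the
left side reduces to g s⁻¹(P² + P)s⁻¹ g, and P² + P = R² - I/4 = sTs. -/
theorem bridge_terminal_identity (hg : IsUnit g) (hs : IsUnit s) (hF : IsUnit F)
    (hFdef : F = s * s + (1 / 2 : ℝ) • 1 - R) (hR : R * R = s * T * s + (1 / 4 : ℝ) • 1) :
    (g * s * F⁻¹ * s * g - g * g) *
      ((g * s * F⁻¹ * s * g)⁻¹ * (g * s * s * g - g * s * F⁻¹ * s * g) *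
        (g * s * F⁻¹ * s * g)⁻¹) * (g * s * F⁻¹ * s * g - g * g) +
      (g * s * F⁻¹ * s * g - g * g) = g * T * g := by
  have dg := (Matrix.isUnit_iff_isUnit_det _).1 hg
  have ds := (Matrix.isUnit_iff_isUnit_det _).1 hs
  have hQu : IsUnit (g * s * F⁻¹ * s * g) :=
    (((hg.mul hs).mul ((Matrix.isUnit_nonsing_inv_iff).2 hF)).mul hs).mul hg
  have hdiff := inv_sub_inv_bridgeInitial (g := g) hs hF hFdef
  set Q := g * s * F⁻¹ * s * g with hQ
  have dQ := (Matrix.isUnit_iff_isUnit_det _).1 hQu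
  set P := R - (1 / 2 : ℝ) • (1 : Mat n n) with hP
  have hGG : (g * g) * (g * g)⁻¹ = 1 := Matrix.mul_nonsing_inv _
    ((Matrix.isUnit_iff_isUnit_det _).1 (hg.mul hg))
  have hGG' : (g * g)⁻¹ * (g * g) = 1 := Matrix.nonsing_inv_mul _
    ((Matrix.isUnit_iff_isUnit_det _).1 (hg.mul hg))
  have h1 : (Q - g * g) * Q⁻¹ = g * (s⁻¹ * P * s⁻¹) * g⁻¹ := by
    have : (Q - g * g) * Q⁻¹ = (g * g) * ((g * g)⁻¹ - Q⁻¹) := by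
      rw [sub_mul, Matrix.mul_nonsing_inv _ dQ, mul_sub, hGG]
    rw [this, hdiff]
    simp only [Matrix.mul_assoc, Matrix.mul_nonsing_inv_cancel_left _ _ dg]
  have h2 : Q⁻¹ * (Q - g * g) = g⁻¹ * (s⁻¹ * P * s⁻¹) * g := by
    have : Q⁻¹ * (Q - g * g) = ((g * g)⁻¹ - Q⁻¹) * (g * g) := by
      rw [mul_sub, Matrix.nonsing_inv_mul _ dQ, sub_mul, hGG']
    rw [this, hdiff]
    simp only [Matrix.mul_assoc, Matrix.nonsing_inv_mul_cancel_left _ _ dg]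
  have hPP : P * P + P = s * T * s := by
    have e : P * P + P = R * R - (1 / 4 : ℝ) • 1 := by
      simp only [hP, mul_sub, sub_mul, Matrix.mul_smul, Matrix.smul_mul, Matrix.mul_one,
        Matrix.one_mul]
      module
    rw [e, hR]; abel
  -- Every factor is regrouped into (Q - g²)Q⁻¹ and Q⁻¹(Q - g²), which `h1` and `h2` express through
  -- P.
  have e1 : (Q - g * g) * (Q⁻¹ * (g * s * s * g - Q) * Q⁻¹) * (Q - g * g) + (Q - g * g) =
      ((Q - g * g) * Q⁻¹) * (g * s * s * g) * (Q⁻¹ * (Q - g * g)) +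
      (g * g) * (Q⁻¹ * (Q - g * g)) := by
    have : (g * g) * (Q⁻¹ * (Q - g * g)) =
        (Q - g * g) - (Q - g * g) * Q⁻¹ * Q * (Q⁻¹ * (Q - g * g)) := by
      rw [Matrix.nonsing_inv_mul_cancel_right _ _ dQ, sub_mul Q (g * g) (Q⁻¹ * (Q - g * g)),
        Matrix.mul_nonsing_inv_cancel_left _ _ dQ]
      abel
    rw [this]
    simp only [Matrix.mul_sub, Matrix.sub_mul, Matrix.mul_assoc]
    abel
  rw [e1, h1, h2]
  have e2 : g * (s⁻¹ * P * s⁻¹) * g⁻¹ * (g * s * s * g) * (g⁻¹ * (s⁻¹ * P * s⁻¹) * g) =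
      g * s⁻¹ * (P * P) * s⁻¹ * g := by
    simp only [Matrix.mul_assoc, Matrix.nonsing_inv_mul_cancel_left _ _ dg,
      Matrix.mul_nonsing_inv_cancel_left _ _ dg, Matrix.nonsing_inv_mul_cancel_left _ _ ds,
      Matrix.mul_nonsing_inv_cancel_left _ _ ds]
  have e3 : g * g * (g⁻¹ * (s⁻¹ * P * s⁻¹) * g) = g * s⁻¹ * P * s⁻¹ * g := by
    simp only [Matrix.mul_assoc, Matrix.mul_nonsing_inv_cancel_left _ _ dg]
  have e4 : g * s⁻¹ * (P * P) * s⁻¹ * g + g * s⁻¹ * P * s⁻¹ * g =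
      g * s⁻¹ * (P * P + P) * s⁻¹ * g := by
    simp only [Matrix.mul_assoc, Matrix.mul_add, Matrix.add_mul]
  rw [e2, e3, e4, hPP]
  simp only [Matrix.mul_assoc, Matrix.nonsing_inv_mul_cancel_left _ _ ds,
    Matrix.mul_nonsing_inv_cancel_left _ _ ds]

end InitialMatrix

/-! ### Transition matrices and Gramians -/

section Transition

variable {n m : ℕ} {A : ℕ → Mat n n} {B : ℕ → Mat n m} {N : ℕ}

theorem Phi_self (k : ℕ) : Phi A k k = 1 := by simp [Phi, fwd]

theorem Phi_succ {k l : ℕ} (h : l ≤ k) : Phi A (k + 1) l = A k * Phi A k l := by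
  rw [Phi, Phi, if_pos h, if_pos (by omega), Nat.succ_sub h, fwd, Nat.add_sub_cancel' h]

theorem Phi_eq_mul {k l j : ℕ} (h : l ≤ k) (hj : j ≤ l) :
    Phi A k j = Phi A k l * Phi A l j := by
  induction k, h using Nat.le_induction with
  | base => rw [Phi_self, one_mul]
  | succ k hk ih => rw [Phi_succ hk, Phi_succ (hj.trans hk), ih, mul_assoc]

theorem Phi_pred {k l : ℕ} (h : l < k) : Phi A k l = Phi A k (l + 1) * A l := by
  rw [Phi_eq_mul (l := l + 1) h (Nat.le_succ l), Phi_succ le_rfl, Phi_self, mul_one]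

theorem isUnit_Phi_zero (hA : ∀ k < N, IsUnit (A k)) {k : ℕ} (hk : k ≤ N) :
    IsUnit (Phi A k 0) := by
  induction k with
  | zero => rw [Phi_self]; exact isUnit_one
  | succ k ih => rw [Phi_succ (Nat.zero_le k)]; exact (hA k hk).mul (ih (by omega))

theorem Phi_zero_succ (k : ℕ) : Phi A 0 (k + 1) = Phi A 0 k * (A k)⁻¹ := by
  rcases Nat.eq_zero_or_pos k with rfl | hk
  · simp [Phi, bwd, fwd]
  · rw [Phi, Phi, if_neg (by omega), if_neg (by omega)]; simp [bwd]

/-- No invertibility is required: reversal of products holds for the totalized matrix inverse as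
well. -/
theorem Phi_zero_eq_inv (k : ℕ) :
    Phi A 0 k = (Phi A k 0)⁻¹ := by
  induction k with
  | zero => simp [Phi_self]
  | succ k ih => rw [Phi_zero_succ, Phi_succ (Nat.zero_le k), Matrix.mul_inv_rev, ih]

theorem gramC_succ (k : ℕ) : gramC A B (k + 1) 0 =
    gramC A B k 0 + (Phi A 0 (k + 1) * B k) * (Phi A 0 (k + 1) * B k)ᵀ := by
  rw [gramC, gramC, Finset.sum_Ico_succ_top (Nat.zero_le k), Matrix.transpose_mul]
  simp only [Matrix.mul_assoc]

theorem posSemidef_mul_transpose_self {p q : ℕ} (C : Mat p q) : (C * Cᵀ).PosSemidef := by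
  simpa using Matrix.posSemidef_self_mul_conjTranspose C

theorem gramC_posSemidef (k : ℕ) : (gramC A B k 0).PosSemidef := by
  induction k with
  | zero => simpa [gramC] using Matrix.PosSemidef.zero
  | succ k ih => rw [gramC_succ]; exact ih.add (posSemidef_mul_transpose_self _)

theorem gramC_sub_posSemidef {k l : ℕ} (h : k ≤ l) :
    (gramC A B l 0 - gramC A B k 0).PosSemidef := by
  induction l, h using Nat.le_induction with
  | base => simpa using Matrix.PosSemidef.zero
  | succ l hl ih =>
    rw [gramC_succ, add_sub_right_comm]; exact ih.add (posSemidef_mul_transpose_self _)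

/-- Lets every B_k be pulled back to time 0, where the recursion for Q becomes subtraction of
Gramians. -/
theorem Phi_succ_zero_mul (hA : ∀ k < N, IsUnit (A k)) {k : ℕ} (hk : k < N) :
    Phi A (k + 1) 0 * (Phi A 0 (k + 1) * B k) = B k := by
  rw [Phi_zero_eq_inv, Matrix.mul_nonsing_inv_cancel_left _ _
    ((Matrix.isUnit_iff_isUnit_det _).1 (isUnit_Phi_zero hA hk))]

theorem gramR_eq_conj_gramC (hA : ∀ k < N, IsUnit (A k)) :
    gramR A B N 0 = Phi A N 0 * gramC A B N 0 * (Phi A N 0)ᵀ := by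
  rw [gramR, gramC, Finset.mul_sum, Finset.sum_mul]
  refine Finset.sum_congr rfl fun k hk => ?_
  have hk : k + 1 ≤ N := (Finset.mem_Ico.1 hk).2
  have h : Phi A N (k + 1) * B k = Phi A N 0 * (Phi A 0 (k + 1) * B k) := by
    rw [Phi_eq_mul hk (Nat.zero_le _), Matrix.mul_assoc, Phi_succ_zero_mul hA hk]
  have e1 : Phi A N (k + 1) * B k * (B k)ᵀ * (Phi A N (k + 1))ᵀ =
      (Phi A N (k + 1) * B k) * (Phi A N (k + 1) * B k)ᵀ := by
    simp only [Matrix.transpose_mul, Matrix.mul_assoc]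
  rw [e1, h]
  simp only [Matrix.transpose_mul, Matrix.mul_assoc]

theorem gramC_posDef (hA : ∀ k < N, IsUnit (A k)) (hG : IsUnit (gramR A B N 0)) :
    (gramC A B N 0).PosDef := by
  rw [(gramC_posSemidef N).posDef_iff_isUnit]
  have hu := isUnit_Phi_zero hA le_rfl
  rw [gramR_eq_conj_gramC hA] at hG
  have hG' := (Matrix.isUnit_iff_isUnit_det _).1 hG
  rw [Matrix.det_mul, Matrix.det_mul] at hG'
  exact (Matrix.isUnit_iff_isUnit_det _).2 (isUnit_of_mul_isUnit_right
    (isUnit_of_mul_isUnit_left hG'))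

end Transition

/-! ### Absence of breakdown and the closed-loop covariances -/

/-- `Q` solves the Riccati (Lyapunov) recursion without breakdown on `{0, …, N}`. -/
structure IsRiccatiSolution {n m : ℕ} (N : ℕ) (A : ℕ → Mat n n) (B : ℕ → Mat n m)
    (Q : ℕ → Mat n n) : Prop where
  isUnit_state : ∀ k < N, IsUnit (A k)
  isUnit : ∀ k ≤ N, IsUnit (Q k)
  isSymm : ∀ k ≤ N, (Q k).IsSymm
  step : ∀ k, Q (k + 1) = A k * Q k * (A k)ᵀ - B k * (B k)ᵀ
  posDef : ∀ k < N, (1 + (B k)ᵀ * (Q (k + 1))⁻¹ * B k).PosDef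

/-- The feedback gain `(I + Bᵀ Q⁻¹ B)⁻¹ Bᵀ Q⁻¹ A`. -/
noncomputable def feedbackGain {n m : ℕ} (A : Mat n n) (B : Mat n m) (Q : Mat n n) : Mat m n :=
  (1 + Bᵀ * Q⁻¹ * B)⁻¹ * Bᵀ * Q⁻¹ * A

/-- `Sig` is the sequence of covariances of the closed-loop system. -/
structure IsClosedLoopCovariance {n m : ℕ} (N : ℕ) (A : ℕ → Mat n n) (B : ℕ → Mat n m) (ε : ℝ)
    (Q Sig : ℕ → Mat n n) : Prop where
  posDef : ∀ k ≤ N, (Sig k).PosDef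
  step : ∀ k < N, Sig (k + 1) =
    (A k - B k * feedbackGain (A k) (B k) (Q (k + 1))) * Sig k *
      (A k - B k * feedbackGain (A k) (B k) (Q (k + 1)))ᵀ +
    B k * (ε • (1 + (B k)ᵀ * (Q (k + 1))⁻¹ * B k)⁻¹) * (B k)ᵀ

section Lyapunov

variable {n m N : ℕ} {A : ℕ → Mat n n} {B : ℕ → Mat n m} {ε : ℝ} {Sig₀ SigN : Mat n n}

theorem S₀_posDef (hε : 0 < ε) (hG : (gramC A B N 0).PosDef) (hSig₀ : Sig₀.PosDef) :
    (S₀ N A B ε Sig₀).PosDef := by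
  have hg := (msqrt_posDef hG).inv
  have := hSig₀.conj_of_isUnit hg.isUnit
  rw [hg.isSymm.eq] at this
  exact this.smul (by positivity)

theorem S_N_posDef (hε : 0 < ε) (hA : ∀ k < N, IsUnit (A k)) (hG : (gramC A B N 0).PosDef)
    (hSigN : SigN.PosDef) : (S_N N A B ε SigN).PosDef := by
  have hg := (msqrt_posDef hG).inv
  have hu : IsUnit (Phi A 0 N) := by
    rw [Phi_zero_eq_inv]; exact (Matrix.isUnit_nonsing_inv_iff).2 (isUnit_Phi_zero hA le_rfl)
  have := hSigN.conj_of_isUnit (hg.isUnit.mul hu)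
  rw [Matrix.transpose_mul, hg.isSymm.eq] at this
  refine Matrix.PosDef.smul ?_ (show 0 < 1 / ε by positivity)
  simpa only [Matrix.mul_assoc] using this

theorem smul_conj_S₀ (hε : 0 < ε) (hG : (gramC A B N 0).PosDef) :
    ε • (msqrt (gramC A B N 0) * S₀ N A B ε Sig₀ * msqrt (gramC A B N 0)) = Sig₀ := by
  have dg := (Matrix.isUnit_iff_isUnit_det _).1 (msqrt_posDef hG).isUnit
  rw [S₀]
  simp only [Matrix.mul_smul, Matrix.smul_mul, smul_smul, Matrix.mul_assoc,
    Matrix.mul_nonsing_inv_cancel_left _ _ dg, Matrix.nonsing_inv_mul _ dg, Matrix.mul_one]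
  rw [mul_one_div_cancel hε.ne', one_smul]

theorem smul_conj_S_N (hε : 0 < ε) (hG : (gramC A B N 0).PosDef) :
    ε • (msqrt (gramC A B N 0) * S_N N A B ε SigN * msqrt (gramC A B N 0)) =
      Phi A 0 N * SigN * (Phi A 0 N)ᵀ := by
  have dg := (Matrix.isUnit_iff_isUnit_det _).1 (msqrt_posDef hG).isUnit
  rw [S_N]
  simp only [Matrix.mul_smul, Matrix.smul_mul, smul_smul, Matrix.mul_assoc,
    Matrix.mul_nonsing_inv_cancel_left _ _ dg, Matrix.nonsing_inv_mul _ dg, Matrix.mul_one]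
  rw [mul_one_div_cancel hε.ne', one_smul]

theorem Q₀_eq : Q₀ N A B ε Sig₀ SigN = msqrt (gramC A B N 0) * msqrt (S₀ N A B ε Sig₀) *
    (calF (S₀ N A B ε Sig₀) (S_N N A B ε SigN))⁻¹ * msqrt (S₀ N A B ε Sig₀) *
      msqrt (gramC A B N 0) := rfl

/-- In time-0 coordinates the factors A_k disappear and each step subtracts one Gramian summand. -/
theorem Qminus_eq_conj (hA : ∀ k < N, IsUnit (A k)) {k : ℕ} (hk : k ≤ N) :
    Qminus N A B ε Sig₀ SigN k =
      Phi A k 0 * (Q₀ N A B ε Sig₀ SigN - gramC A B k 0) * (Phi A k 0)ᵀ := by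
  induction k with
  | zero => simp [Qminus, Phi_self, gramC]
  | succ k ih =>
    have h := Phi_succ_zero_mul (B := B) hA hk
    rw [Qminus, ih (by omega), gramC_succ]
    have e : B k * (B k)ᵀ = Phi A (k + 1) 0 * ((Phi A 0 (k + 1) * B k) *
        (Phi A 0 (k + 1) * B k)ᵀ) * (Phi A (k + 1) 0)ᵀ := by
      have : Phi A (k + 1) 0 * ((Phi A 0 (k + 1) * B k) * (Phi A 0 (k + 1) * B k)ᵀ) *
        (Phi A (k + 1) 0)ᵀ = (Phi A (k + 1) 0 * (Phi A 0 (k + 1) * B k)) *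
          (Phi A (k + 1) 0 * (Phi A 0 (k + 1) * B k))ᵀ := by
        simp only [Matrix.transpose_mul, Matrix.mul_assoc]
      rw [this, h]
    rw [e, ← sub_sub, Matrix.mul_sub _ (_ - _), Matrix.sub_mul _ _ (Phi A (k + 1) 0)ᵀ,
      Phi_succ (Nat.zero_le k)]
    simp only [Matrix.transpose_mul, Matrix.mul_assoc]

theorem calF_isSymm (hS₀ : (S₀ N A B ε Sig₀).PosDef) :
    (calF (S₀ N A B ε Sig₀) (S_N N A B ε SigN)).IsSymm := by
  refine (hS₀.isSymm.add ?_).sub (msqrt_posSemidef _).isSymm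
  exact Matrix.isSymm_one.smul _

theorem Q₀_isSymm (hS₀ : (S₀ N A B ε Sig₀).PosDef) : (Q₀ N A B ε Sig₀ SigN).IsSymm := by
  rw [Q₀_eq, Matrix.IsSymm]
  simp only [Matrix.transpose_mul, (msqrt_posSemidef _).isSymm.eq,
    (calF_isSymm hS₀).inv.eq, Matrix.mul_assoc]

theorem Q₀_isUnit (hG : (gramC A B N 0).PosDef) (hS₀ : (S₀ N A B ε Sig₀).PosDef)
    (hF : IsUnit (calF (S₀ N A B ε Sig₀) (S_N N A B ε SigN))) :
    IsUnit (Q₀ N A B ε Sig₀ SigN) := by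
  have hg := (msqrt_posDef hG).isUnit
  have hs := (msqrt_posDef hS₀).isUnit
  exact (((hg.mul hs).mul ((Matrix.isUnit_nonsing_inv_iff).2 hF)).mul hs).mul hg

theorem calF_eq (hS₀ : (S₀ N A B ε Sig₀).PosDef) :
    calF (S₀ N A B ε Sig₀) (S_N N A B ε SigN) =
      msqrt (S₀ N A B ε Sig₀) * msqrt (S₀ N A B ε Sig₀) + (1 / 2 : ℝ) • 1 -
      msqrt (msqrt (S₀ N A B ε Sig₀) * S_N N A B ε SigN * msqrt (S₀ N A B ε Sig₀) +
        (1 / 4 : ℝ) • 1) := by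
  rw [msqrt_mul_msqrt hS₀.posSemidef, calF]

theorem conj_S_N_posDef (hS₀ : (S₀ N A B ε Sig₀).PosDef) (hS_N : (S_N N A B ε SigN).PosDef) :
    (msqrt (S₀ N A B ε Sig₀) * S_N N A B ε SigN * msqrt (S₀ N A B ε Sig₀)).PosDef := by
  have hs := msqrt_posDef hS₀
  have := hS_N.conj_of_isUnit hs.isUnit
  rwa [hs.isSymm.eq] at this

theorem inv_gramC_sub_inv_Q₀_posDef (hG : (gramC A B N 0).PosDef)
    (hS₀ : (S₀ N A B ε Sig₀).PosDef) (hS_N : (S_N N A B ε SigN).PosDef)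
    (hF : IsUnit (calF (S₀ N A B ε Sig₀) (S_N N A B ε SigN))) :
    ((gramC A B N 0)⁻¹ - (Q₀ N A B ε Sig₀ SigN)⁻¹).PosDef := by
  have hg := msqrt_posDef hG
  have hs := msqrt_posDef hS₀
  have h := inv_sub_inv_bridgeInitial (g := msqrt (gramC A B N 0)) hs.isUnit hF (calF_eq hS₀)
  rw [msqrt_mul_msqrt hG.posSemidef] at h
  rw [Q₀_eq, h]
  have := (posDef_msqrt_sub_half (conj_S_N_posDef hS₀ hS_N)).conj_of_isUnit
    (hg.inv.isUnit.mul hs.inv.isUnit)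
  rwa [Matrix.transpose_mul, hg.inv.isSymm.eq, hs.inv.isSymm.eq] at this

/-- In time-0 coordinates the ordering lemmas apply with G = G_c(N,0), H = G_c(k,0) and C =
Φ(0,k+1)B_k, because H + CCᵀ = G_c(k+1,0) ⪯ G. -/
theorem isRiccatiSolution_Qminus (hε : 0 < ε) (hA : ∀ k < N, IsUnit (A k))
    (hG : IsUnit (gramR A B N 0)) (hSig₀ : Sig₀.PosDef) (hSigN : SigN.PosDef)
    (hF : IsUnit (calF (S₀ N A B ε Sig₀) (S_N N A B ε SigN))) :
    IsRiccatiSolution N A B (Qminus N A B ε Sig₀ SigN) := by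
  have hGc := gramC_posDef hA hG
  have hS₀ := S₀_posDef hε hGc hSig₀
  have hS_N := S_N_posDef hε hA hGc hSigN
  have hQ := Q₀_isUnit hGc hS₀ hF
  have hQs : (Q₀ N A B ε Sig₀ SigN).IsSymm := Q₀_isSymm hS₀
  have hD := inv_gramC_sub_inv_Q₀_posDef hGc hS₀ hS_N hF
  have hu : ∀ k ≤ N, IsUnit (Q₀ N A B ε Sig₀ SigN - gramC A B k 0) := fun k hk =>
    isUnit_sub_of_inv_lt hGc hQ hD (gramC_posSemidef k) (gramC_sub_posSemidef hk)
  refine ⟨hA, fun k hk => ?_, fun k hk => ?_, fun k => rfl, fun k hk => ?_⟩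
  · rw [Qminus_eq_conj hA hk]
    have := isUnit_Phi_zero hA hk
    exact (this.mul (hu k hk)).mul (by simpa using this)
  · rw [Qminus_eq_conj hA hk, Matrix.IsSymm]
    simp only [Matrix.transpose_mul, Matrix.transpose_transpose,
      (hQs.sub (gramC_posSemidef k).isSymm).eq, Matrix.mul_assoc]
  · set C := Phi A 0 (k + 1) * B k with hC
    have hPhi := isUnit_Phi_zero hA (Nat.succ_le_of_lt hk)
    have dPhi := (Matrix.isUnit_iff_isUnit_det _).1 hPhi
    have dPhiT : IsUnit (Phi A (k + 1) 0)ᵀ.det := by simpa using dPhi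
    have hle : (gramC A B N 0 - gramC A B k 0 - C * Cᵀ).PosSemidef := by
      rw [sub_sub, ← gramC_succ]; exact gramC_sub_posSemidef hk
    have h1 := posDef_one_sub_of_inv_lt hGc hQ hQs hD (gramC_posSemidef k) hle
    have h2 := one_add_mul_one_sub_woodbury (C := C) (hu (k + 1) hk) (hu k hk.le)
      (by rw [gramC_succ, sub_sub])
    have h3 := h1.of_mul_eq_one h2
    have e : (B k)ᵀ * (Qminus N A B ε Sig₀ SigN (k + 1))⁻¹ * B k =
        Cᵀ * (Q₀ N A B ε Sig₀ SigN - gramC A B (k + 1) 0)⁻¹ * C := by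
      have hB : B k = Phi A (k + 1) 0 * C := (Phi_succ_zero_mul hA hk).symm
      rw [Qminus_eq_conj hA hk]
      rw [hB]
      simp only [Matrix.transpose_mul, Matrix.mul_inv_rev, Matrix.mul_assoc,
        Matrix.nonsing_inv_mul_cancel_left _ _ dPhi, Matrix.mul_nonsing_inv_cancel_left _ _ dPhiT]
    rw [e]; exact h3

theorem exists_isClosedLoopCovariance (hε : 0 < ε) (hA : ∀ k < N, IsUnit (A k))
    (hG : IsUnit (gramR A B N 0)) (hSig₀ : Sig₀.PosDef) (hSigN : SigN.PosDef)
    (hF : IsUnit (calF (S₀ N A B ε Sig₀) (S_N N A B ε SigN))) :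
    ∃ Sig : ℕ → Mat n n, Sig 0 = Sig₀ ∧ Sig N = SigN ∧
      IsClosedLoopCovariance N A B ε (Qminus N A B ε Sig₀ SigN) Sig := by
  have hGc := gramC_posDef hA hG
  have hS₀ := S₀_posDef hε hGc hSig₀
  have hS_N := S_N_posDef hε hA hGc hSigN
  have hQ := Q₀_isUnit hGc hS₀ hF
  have dQ := (Matrix.isUnit_iff_isUnit_det _).1 hQ
  have hric := isRiccatiSolution_Qminus hε hA hG hSig₀ hSigN hF
  set Q := Qminus N A B ε Sig₀ SigN with hQdef
  set q := Q₀ N A B ε Sig₀ SigN with hq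
  -- The solution of qYq + εq = Σ₀.
  set Y := q⁻¹ * (Sig₀ - ε • q) * q⁻¹ with hY
  -- The transport of Y that satisfies the hypothesis of `closedLoop_covariance_step`.
  let Yk : ℕ → Mat n n := fun k => (Phi A 0 k)ᵀ * Y * Phi A 0 k
  let Sig : ℕ → Mat n n := fun k => Q k * Yk k * Q k + ε • Q k
  have hYk : ∀ k < N, Yk k = (A k)ᵀ * Yk (k + 1) * A k := fun k hk => by
    have dA := (Matrix.isUnit_iff_isUnit_det _).1 (hA k hk)
    have dAT : IsUnit (A k)ᵀ.det := by simpa using dA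
    simp only [Yk, Phi_zero_succ, Matrix.transpose_mul, Matrix.transpose_nonsing_inv,
      Matrix.mul_assoc, Matrix.mul_nonsing_inv_cancel_left _ _ dAT, Matrix.nonsing_inv_mul _ dA,
      Matrix.mul_one]
  have hstep := fun k (hk : k < N) => closedLoop_covariance_step ε (hric.isUnit k hk.le) (hA k hk)
    (hric.isUnit (k + 1) hk) (hric.isSymm (k + 1) hk) (hric.isSymm k hk.le) (hric.step k)
    (hYk k hk)
  have h0 : Sig 0 = Sig₀ := by
    have : Q 0 = q := rfl
    simp only [Sig, Yk, this, Phi_self, Matrix.transpose_one, Matrix.one_mul, Matrix.mul_one, hY,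
      Matrix.mul_assoc, Matrix.mul_nonsing_inv_cancel_left _ _ dQ, Matrix.nonsing_inv_mul _ dQ]
    abel
  refine ⟨Sig, h0, ?_, ?_, ?_⟩
  · have hPhi := isUnit_Phi_zero hA le_rfl
    have dPhi := (Matrix.isUnit_iff_isUnit_det _).1 hPhi
    have dPhiT : IsUnit (Phi A N 0)ᵀ.det := by simpa using dPhi
    have hg := msqrt_posDef hGc
    have hs := msqrt_posDef hS₀
    have hterm := bridge_terminal_identity hg.isUnit hs.isUnit hF (calF_eq hS₀)
      (msqrt_mul_msqrt ((conj_S_N_posDef hS₀ hS_N).posSemidef.add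
        (Matrix.PosDef.one.smul (show (0 : ℝ) < 1 / 4 by norm_num)).posSemidef))
    rw [← Q₀_eq, msqrt_mul_msqrt hGc.posSemidef, ← hq,
      Matrix.mul_assoc (msqrt (gramC A B N 0)) (msqrt (S₀ N A B ε Sig₀)),
      msqrt_mul_msqrt hS₀.posSemidef] at hterm
    have hterm' := congrArg (fun M => ε • M) hterm
    simp only [smul_conj_S_N hε hGc, smul_add] at hterm'
    rw [← Matrix.smul_mul, ← Matrix.mul_smul, ← Matrix.smul_mul, ← Matrix.mul_smul, smul_sub,
      smul_conj_S₀ hε hGc, ← hY] at hterm'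
    have hQN : Q N = Phi A N 0 * (q - gramC A B N 0) * (Phi A N 0)ᵀ := Qminus_eq_conj hA le_rfl
    have e : Sig N = Phi A N 0 * ((q - gramC A B N 0) * Y * (q - gramC A B N 0) +
        ε • (q - gramC A B N 0)) * (Phi A N 0)ᵀ := by
      simp only [Sig, Yk, hQN, Phi_zero_eq_inv, Matrix.transpose_nonsing_inv, Matrix.mul_assoc,
        Matrix.mul_nonsing_inv_cancel_left _ _ dPhiT, Matrix.nonsing_inv_mul_cancel_left _ _ dPhi,
        Matrix.mul_add, Matrix.add_mul, Matrix.mul_smul, Matrix.smul_mul]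
    rw [e, hterm', Phi_zero_eq_inv, Matrix.transpose_nonsing_inv]
    simp only [Matrix.mul_assoc, Matrix.mul_nonsing_inv_cancel_left _ _ dPhi,
      Matrix.nonsing_inv_mul _ dPhiT, Matrix.mul_one]
  -- Positivity is invisible in the closed form, as Q_k may be indefinite. It propagates instead:
  -- congruence by the invertible closed-loop matrix, plus a positive semidefinite noise term.
  · intro k hk
    induction k with
    | zero => rw [h0]; exact hSig₀
    | succ k ih =>
      have h := (hstep k hk).1
      change _ = Sig (k + 1) at h
      rw [← h]
      refine ((ih (by omega)).conj_of_isUnit (hstep k hk).2).add_posSemidef ?_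
      have hW := ((hric.posDef k hk).inv.smul hε).posSemidef
      simpa using hW.mul_mul_conjTranspose_same (B k)
  · intro k hk
    exact (hstep k hk).1.symm

end Lyapunov

/-! ### Matrices acting on Euclidean spaces -/

section MulV

variable {p q r : ℕ}

theorem mulV_add (M : Mat p q) (v w : Vec q) : mulV M (v + w) = mulV M v + mulV M w := by
  simp [mulV, Matrix.mulVec_add]

theorem mulV_sub (M : Mat p q) (v w : Vec q) : mulV M (v - w) = mulV M v - mulV M w := by
  simp [mulV, Matrix.mulVec_sub]

theorem mulV_smul (M : Mat p q) (c : ℝ) (v : Vec q) : mulV M (c • v) = c • mulV M v := by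
  simp [mulV, Matrix.mulVec_smul]

theorem mulV_mulV (M : Mat p q) (K : Mat q r) (v : Vec r) :
    mulV M (mulV K v) = mulV (M * K) v := by
  simp [mulV]

theorem sub_mulV (M K : Mat p q) (v : Vec q) : mulV (M - K) v = mulV M v - mulV K v := by
  simp [mulV, Matrix.sub_mulVec]

theorem one_mulV (v : Vec p) : mulV (1 : Mat p p) v = v := by
  simp [mulV]

/-- `mulV M` as a continuous linear map. -/
noncomputable def mulVL (M : Mat p q) : Vec q →L[ℝ] Vec p :=
  LinearMap.toContinuousLinearMap
    { toFun := mulV M, map_add' := mulV_add M, map_smul' := mulV_smul M }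

@[fun_prop]
theorem continuous_mulV (M : Mat p q) : Continuous (mulV M) := (mulVL M).continuous

@[fun_prop]
theorem measurable_mulV (M : Mat p q) : Measurable (mulV M) := (continuous_mulV M).measurable

theorem mulV_sum {ι : Type*} (M : Mat p q) (s : Finset ι) (f : ι → Vec q) :
    mulV M (∑ i ∈ s, f i) = ∑ i ∈ s, mulV M (f i) := map_sum (mulVL M) f s

theorem sum_mulV {ι : Type*} (s : Finset ι) (M : ι → Mat p q) (v : Vec q) :
    mulV (∑ i ∈ s, M i) v = ∑ i ∈ s, mulV (M i) v := by
  induction s using Finset.cons_induction with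
  | empty => simp [mulV]
  | cons a s ha ih =>
    rw [Finset.sum_cons, Finset.sum_cons, ← ih]; simp [mulV, Matrix.add_mulVec]

theorem inner_eq_dotProduct (v w : Vec p) : inner ℝ v w = v.ofLp ⬝ᵥ w.ofLp := by
  rw [EuclideanSpace.inner_eq_star_dotProduct, star_trivial, dotProduct_comm]

theorem inner_mulV (M : Mat p q) (v : Vec p) (w : Vec q) :
    inner ℝ v (mulV M w) = inner ℝ (mulV Mᵀ v) w := by
  rw [inner_eq_dotProduct, inner_eq_dotProduct]
  exact dotProduct_mulVec_transpose M v.ofLp w.ofLp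

end MulV

/-! ### Minimum-energy steering of the mean -/

section MeanSteering

variable {n m N : ℕ} {A : ℕ → Mat n n} {B : ℕ → Mat n m}

theorem detState_eq (mu₀ : Vec n) (v : ℕ → Vec m) (k : ℕ) :
    detState A B mu₀ v k = mulV (Phi A k 0) mu₀ +
      ∑ s ∈ Finset.range k, mulV (Phi A k (s + 1) * B s) (v s) := by
  induction k with
  | zero => simp [detState, Phi_self, one_mulV]
  | succ k ih =>
    rw [detState, ih, Finset.sum_range_succ, mulV_add, mulV_sum, mulV_mulV,
      Phi_succ (Nat.zero_le k), Phi_self, Matrix.one_mul, add_assoc]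
    congr 2
    refine Finset.sum_congr rfl fun s hs => ?_
    rw [mulV_mulV, Phi_succ (Finset.mem_range.1 hs), Matrix.mul_assoc]

theorem meanState_eq_detState (mu₀ muN : Vec n) (k : ℕ) :
    meanState N A B mu₀ muN k = detState A B mu₀ (meanInput N A B mu₀ muN) k :=
  (detState_eq _ _ _).symm

theorem meanState_succ (mu₀ muN : Vec n) (k : ℕ) :
    meanState N A B mu₀ muN (k + 1) =
      mulV (A k) (meanState N A B mu₀ muN k) + mulV (B k) (meanInput N A B mu₀ muN k) := by
  rw [meanState_eq_detState, meanState_eq_detState, detState]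

/-- The costate at time `N`: `G_r(N,0)⁻¹ (μ_N - Φ(N,0) μ₀)`. -/
noncomputable def costate (N : ℕ) (A : ℕ → Mat n n) (B : ℕ → Mat n m) (mu₀ muN : Vec n) : Vec n :=
  mulV (gramR A B N 0)⁻¹ (muN - mulV (Phi A N 0) mu₀)

theorem meanInput_eq (mu₀ muN : Vec n) (k : ℕ) :
    meanInput N A B mu₀ muN k = mulV (Phi A N (k + 1) * B k)ᵀ (costate N A B mu₀ muN) := by
  rw [meanInput, costate, mulV_mulV, Matrix.transpose_mul]

theorem detState_meanInput (hG : IsUnit (gramR A B N 0)) (mu₀ muN : Vec n) :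
    detState A B mu₀ (meanInput N A B mu₀ muN) N = muN := by
  have h : ∑ s ∈ Finset.range N, mulV (Phi A N (s + 1) * B s) (meanInput N A B mu₀ muN s) =
      mulV (gramR A B N 0) (costate N A B mu₀ muN) := by
    rw [gramR, sum_mulV, Finset.range_eq_Ico]
    refine Finset.sum_congr rfl fun s _ => ?_
    rw [meanInput_eq, mulV_mulV, Matrix.transpose_mul]
    simp only [Matrix.mul_assoc]
  rw [detState_eq, h, costate, mulV_mulV,
    Matrix.mul_nonsing_inv _ ((Matrix.isUnit_iff_isUnit_det _).1 hG), one_mulV]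
  abel

/-- Pythagoras: the input is v_s = (Φ(N,s+1)B_s)ᵀλ with λ the costate, so its inner product with w -
v is λ paired with the difference of two terminal states, which is 0. -/
theorem isUniqueMinEnergyInput_meanInput (hG : IsUnit (gramR A B N 0)) (mu₀ muN : Vec n) :
    IsUniqueMinEnergyInput N A B mu₀ muN (meanInput N A B mu₀ muN) := by
  set v := meanInput N A B mu₀ muN with hv
  have hst : detState A B mu₀ v N = muN := detState_meanInput hG mu₀ muN
  have key : ∀ w : ℕ → Vec m, detState A B mu₀ w N = muN →
      ∑ k ∈ Finset.range N, (1 / 2) * ‖w k‖ ^ 2 = ∑ k ∈ Finset.range N, (1 / 2) * ‖v k‖ ^ 2 +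
        ∑ k ∈ Finset.range N, (1 / 2) * ‖w k - v k‖ ^ 2 := by
    intro w hw
    have hsum : ∑ s ∈ Finset.range N, mulV (Phi A N (s + 1) * B s) (w s - v s) = 0 := by
      have := hw.trans hst.symm
      rw [detState_eq, detState_eq, add_right_inj] at this
      simp only [mulV_sub, Finset.sum_sub_distrib, this, sub_self]
    have hort : ∑ s ∈ Finset.range N, inner ℝ (v s) (w s - v s) = 0 := by
      have : ∀ s, inner ℝ (v s) (w s - v s) =
          inner ℝ (costate N A B mu₀ muN) (mulV (Phi A N (s + 1) * B s) (w s - v s)) := fun s => by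
        rw [inner_mulV, hv, meanInput_eq]
      simp only [this]
      rw [← inner_sum, hsum, inner_zero_right]
    have : ∀ s, (1 / 2) * ‖w s‖ ^ 2 = (1 / 2) * ‖v s‖ ^ 2 + (1 / 2) * ‖w s - v s‖ ^ 2 +
        inner ℝ (v s) (w s - v s) := fun s => by
      have := norm_add_sq_real (v s) (w s - v s)
      rw [add_sub_cancel] at this
      linarith
    simp only [this, Finset.sum_add_distrib, hort, add_zero]
  refine ⟨hst, fun w hw => ?_, fun w hw he k hk => ?_⟩
  · rw [key w hw]
    exact le_add_of_nonneg_right (Finset.sum_nonneg fun _ _ => by positivity)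
  · rw [key w hw, add_eq_left,
      Finset.sum_eq_zero_iff_of_nonneg fun _ _ => by positivity] at he
    have := he k (Finset.mem_range.2 hk)
    simpa [sub_eq_zero] using this

end MeanSteering

/-! ### Gaussian densities and Gaussian measures -/

section GaussianDensity

variable {m : ℕ}

theorem gaussDensity_eq (a : Vec m) (S : Mat m m) (u : Vec m) :
    gaussDensity a S u = (Real.sqrt ((2 * Real.pi) ^ m * S.det))⁻¹ *
      Real.exp (-(1 / 2) * inner ℝ (u - a) (mulV S⁻¹ (u - a))) := by
  rw [inner_eq_dotProduct]; rfl

theorem gaussDensity_add (a : Vec m) (S : Mat m m) (w : Vec m) :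
    gaussDensity a S (a + w) = gaussDensity 0 S w := by
  simp [gaussDensity_eq]

theorem measurable_gaussDensity (S : Mat m m) {X : Type*} [MeasurableSpace X] {f g : X → Vec m}
    (hf : Measurable f) (hg : Measurable g) :
    Measurable fun z => gaussDensity (f z) S (g z) := by
  simp only [gaussDensity_eq]
  have h : Measurable fun z => g z - f z := hg.sub hf
  have h2 : Measurable fun z => mulV S⁻¹ (g z - f z) := (measurable_mulV _).comp h
  have h3 : Measurable fun z => (inner ℝ (g z - f z) (mulV S⁻¹ (g z - f z)) : ℝ) := h.inner h2
  exact ((h3.const_mul _).exp).const_mul _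

theorem gaussDensity_pos {S : Mat m m} (hS : S.PosDef) (a u : Vec m) : 0 < gaussDensity a S u := by
  rw [gaussDensity_eq]
  have := hS.det_pos
  have := Real.pi_pos
  positivity

theorem gaussDensity_zero_one (u : Vec m) :
    gaussDensity 0 1 u = (Real.sqrt ((2 * Real.pi) ^ m))⁻¹ * Real.exp (-(1 / 2) * ‖u‖ ^ 2) := by
  rw [gaussDensity_eq, inv_one, one_mulV, sub_zero, real_inner_self_eq_norm_sq, Matrix.det_one,
    mul_one]

theorem integrable_gaussDensity_zero_one : Integrable (gaussDensity (0 : Vec m) 1) := by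
  have h := (GaussianFourier.integrable_cexp_neg_mul_sq_norm_add (V := Vec m)
    (b := (1 / 2 : ℂ)) (by norm_num) 0 0).norm
  have h2 : Integrable fun v : Vec m => Real.exp (-(1 / 2) * ‖v‖ ^ 2) := by
    refine h.congr (Filter.Eventually.of_forall fun v => ?_)
    simp only [Complex.norm_exp]
    congr 1
    norm_num [← Complex.ofReal_pow]
  have h3 : (gaussDensity (0 : Vec m) 1) =
      fun u => (Real.sqrt ((2 * Real.pi) ^ m))⁻¹ * Real.exp (-(1 / 2) * ‖u‖ ^ 2) :=
    funext gaussDensity_zero_one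
  rw [h3]
  exact h2.const_mul _

/-- Both finite measures have the same characteristic function, by the Fourier transform of the
Gaussian. -/
theorem stdGaussian_eq_withDensity :
    stdGaussian (Vec m) = volume.withDensity fun u => ENNReal.ofReal (gaussDensity 0 1 u) := by
  have hfin : IsFiniteMeasure
      ((volume : Measure (Vec m)).withDensity fun u => ENNReal.ofReal (gaussDensity 0 1 u)) :=
    isFiniteMeasure_withDensity_ofReal integrable_gaussDensity_zero_one.2
  refine Measure.ext_of_charFun ?_
  ext t
  have hmeas : Measurable fun u : Vec m => ENNReal.ofReal (gaussDensity 0 1 u) :=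
    (measurable_gaussDensity 1 measurable_const measurable_id).ennreal_ofReal
  rw [charFun_stdGaussian, charFun_apply,
    integral_withDensity_eq_integral_toReal_smul hmeas (by simp)]
  have h1 : ∀ x : Vec m, (ENNReal.ofReal (gaussDensity 0 1 x)).toReal •
      Complex.exp ((inner ℝ x t : ℝ) * Complex.I) =
      ((Real.sqrt ((2 * Real.pi) ^ m))⁻¹ : ℝ) *
        Complex.exp (-(1 / 2 : ℂ) * (‖x‖ : ℂ) ^ 2 + Complex.I * (inner ℝ t x : ℝ)) := fun x => by
    rw [ENNReal.toReal_ofReal (gaussDensity_pos Matrix.PosDef.one _ _).le, gaussDensity_zero_one,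
      Complex.exp_add, Complex.real_smul, real_inner_comm]
    push_cast
    ring_nf
  simp only [h1]
  rw [integral_const_mul, GaussianFourier.integral_cexp_neg_mul_sq_norm_add (by norm_num)]
  have h2 : ((Real.pi : ℂ) / (1 / 2)) ^ ((Module.finrank ℝ (Vec m) : ℂ) / 2) =
      (Real.sqrt ((2 * Real.pi) ^ m) : ℝ) := by
    have : ((Real.pi : ℂ) / (1 / 2)) = ((2 * Real.pi : ℝ) : ℂ) := by push_cast; ring
    rw [this, finrank_euclideanSpace_fin, Real.sqrt_eq_rpow, ← Real.rpow_natCast, ← Real.rpow_mul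
      (by positivity), Complex.ofReal_cpow (by positivity)]
    push_cast
    ring_nf
  rw [h2, ← mul_assoc, ← Complex.ofReal_mul, inv_mul_cancel₀ (by positivity), Complex.ofReal_one,
    one_mul, Complex.I_sq]
  congr 1
  ring

/-- Change of variables u = a + S^{1/2}x in the standard Gaussian; the Jacobian det S^{1/2} is the
ratio of the normalizing constants. -/
theorem multivariateGaussian_eq_withDensity (a : Vec m) {S : Mat m m} (hS : S.PosDef) :
    multivariateGaussian a S =
      volume.withDensity fun u => ENNReal.ofReal (gaussDensity a S u) := by
  set T := msqrt S with hT
  have hTp : T.PosDef := msqrt_posDef hS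
  have hTT : T * T = S := msqrt_mul_msqrt hS.posSemidef
  have dT := (Matrix.isUnit_iff_isUnit_det _).1 hTp.isUnit
  have hdet : 0 < T.det := hTp.det_pos
  have hrho : ∀ x, gaussDensity 0 1 x = T.det * gaussDensity a S (a + mulV T x) := fun x => by
    rw [gaussDensity_zero_one, gaussDensity_eq, add_sub_cancel_left, mulV_mulV, real_inner_comm,
      inner_mulV, mulV_mulV, hTp.isSymm.eq, ← hTT, Matrix.mul_inv_rev]
    have : T * (T⁻¹ * T⁻¹ * T) = 1 := by
      rw [Matrix.mul_assoc, Matrix.nonsing_inv_mul _ dT, Matrix.mul_one,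
        Matrix.mul_nonsing_inv _ dT]
    rw [this, one_mulV, real_inner_self_eq_norm_sq, Matrix.det_mul,
      Real.sqrt_mul (by positivity), Real.sqrt_mul_self hdet.le, mul_inv]
    field_simp
  have hlin : LinearMap.det (mulVL T : Vec m →ₗ[ℝ] Vec m) = T.det := by
    have : (mulVL T : Vec m →ₗ[ℝ] Vec m) = Matrix.toLpLin 2 2 T := rfl
    rw [this, Matrix.toLpLin_eq_toLin, LinearMap.det_toLin]
  have hmap : Measure.map (mulV T) (volume : Measure (Vec m)) = ENNReal.ofReal T.det⁻¹ • volume := by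
    have := Measure.map_linearMap_addHaar_eq_smul_addHaar (volume : Measure (Vec m))
      (f := (mulVL T : Vec m →ₗ[ℝ] Vec m)) (by rw [hlin]; exact hdet.ne')
    rw [hlin, abs_of_pos (inv_pos.2 hdet)] at this
    exact this
  have hm1 : Measurable fun x : Vec m => a + mulV T x := (measurable_mulV T).const_add a
  have hm0 : Measurable fun u : Vec m => ENNReal.ofReal (gaussDensity 0 1 u) :=
    (measurable_gaussDensity 1 measurable_const measurable_id).ennreal_ofReal
  have hmS : Measurable fun u : Vec m => ENNReal.ofReal (gaussDensity a S u) :=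
    (measurable_gaussDensity S measurable_const measurable_id).ennreal_ofReal
  have hdef : multivariateGaussian a S = (stdGaussian (Vec m)).map fun x => a + mulV T x := rfl
  rw [hdef, stdGaussian_eq_withDensity]
  refine Measure.ext_of_lintegral _ fun f hf => ?_
  rw [lintegral_map hf hm1, lintegral_withDensity_eq_lintegral_mul _ hm0
      (show Measurable fun x => f (a + mulV T x) from hf.comp hm1),
    lintegral_withDensity_eq_lintegral_mul _ hmS hf]
  simp only [Pi.mul_apply]
  set h : Vec m → ℝ≥0∞ := fun y => ENNReal.ofReal (gaussDensity a S (a + y)) * f (a + y) with hh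
  have h1 : ∀ x, ENNReal.ofReal (gaussDensity 0 1 x) * f (a + mulV T x) =
      ENNReal.ofReal T.det * h (mulV T x) := fun x => by
    rw [hrho, ENNReal.ofReal_mul hdet.le, mul_assoc]
  have hg : Measurable h := (hmS.mul hf).comp (measurable_const_add a)
  rw [lintegral_congr h1, lintegral_const_mul _
      (show Measurable fun x => h (mulV T x) from hg.comp (measurable_mulV T)),
    ← lintegral_map hg (measurable_mulV T), hmap, lintegral_smul_measure, smul_eq_mul, ← mul_assoc,
    ← ENNReal.ofReal_mul hdet.le, mul_inv_cancel₀ hdet.ne', ENNReal.ofReal_one, one_mul]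
  exact lintegral_add_left_eq_self (μ := volume)
    (fun y => ENNReal.ofReal (gaussDensity a S y) * f y) a

theorem lintegral_gaussDensity (a : Vec m) {S : Mat m m} (hS : S.PosDef) :
    ∫⁻ u, ENNReal.ofReal (gaussDensity a S u) = 1 := by
  rw [← setLIntegral_univ, ← withDensity_apply _ MeasurableSet.univ,
    ← multivariateGaussian_eq_withDensity a hS, measure_univ]

theorem volume_absolutelyContinuous_multivariateGaussian (a : Vec m) {S : Mat m m}
    (hS : S.PosDef) : volume ≪ multivariateGaussian a S := by
  rw [multivariateGaussian_eq_withDensity a hS]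
  refine withDensity_absolutelyContinuous' ?_ (Filter.Eventually.of_forall fun u => ?_)
  · exact (measurable_gaussDensity S measurable_const measurable_id).ennreal_ofReal.aemeasurable
  · simpa using gaussDensity_pos hS a u

/-- A Gaussian transition density is the addition of independent Gaussian noise. -/
theorem withDensity_gaussDensity_eq_map {X : Type*} [MeasurableSpace X] (μ : Measure X)
    [SFinite μ] {f : X → Vec m} (hf : Measurable f) {S : Mat m m} (hS : S.PosDef) :
    (μ.prod volume).withDensity (fun z => ENNReal.ofReal (gaussDensity (f z.1) S z.2)) =
      (μ.prod (multivariateGaussian 0 S)).map fun z => (z.1, f z.1 + z.2) := by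
  have hmS : Measurable fun u : Vec m => ENNReal.ofReal (gaussDensity 0 S u) :=
    (measurable_gaussDensity S measurable_const measurable_id).ennreal_ofReal
  have hm : Measurable fun z : X × Vec m => ENNReal.ofReal (gaussDensity (f z.1) S z.2) :=
    (measurable_gaussDensity S (hf.comp measurable_fst) measurable_snd).ennreal_ofReal
  have hs : Measurable fun z : X × Vec m => (z.1, f z.1 + z.2) := by fun_prop
  refine Measure.ext_of_lintegral _ fun g hg => ?_
  rw [lintegral_map hg hs, lintegral_withDensity_eq_lintegral_mul _ hm hg,
    lintegral_prod _ (hm.mul hg).aemeasurable, lintegral_prod _ (show Measurable fun z => g (z.1, f z.1 + z.2) from hg.comp hs).aemeasurable]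
  refine lintegral_congr fun x => ?_
  have hgx : Measurable fun w => g (x, f x + w) := (hg.comp hs).comp measurable_prodMk_left
  rw [multivariateGaussian_eq_withDensity 0 hS, lintegral_withDensity_eq_lintegral_mul _ hmS hgx]
  simp only [Pi.mul_apply]
  rw [← lintegral_add_left_eq_self (μ := volume) _ (f x)]
  simp only [gaussDensity_add]

/-- By independence the characteristic function factors. This is the propagation of the state law
through one closed-loop step. -/
theorem map_affine_prod_multivariateGaussian {n : ℕ} (a c : Vec n) {S : Mat n n} {T : Mat m m}
    (hS : S.PosSemidef) (hT : T.PosSemidef) (L : Mat n n) (B : Mat n m) :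
    ((multivariateGaussian a S).prod (multivariateGaussian 0 T)).map
      (fun z => mulV L z.1 + mulV B z.2 + c) =
      multivariateGaussian (mulV L a + c) (L * S * Lᵀ + B * T * Bᵀ) := by
  have hm : Measurable fun z : Vec n × Vec m => mulV L z.1 + mulV B z.2 + c := by fun_prop
  have hST : (L * S * Lᵀ + B * T * Bᵀ).PosSemidef := by
    have h1 := hS.mul_mul_conjTranspose_same L
    have h2 := hT.mul_mul_conjTranspose_same B
    simpa using h1.add h2
  have : IsProbabilityMeasure (((multivariateGaussian a S).prod (multivariateGaussian 0 T)).map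
      (fun z => mulV L z.1 + mulV B z.2 + c)) := Measure.isProbabilityMeasure_map hm.aemeasurable
  refine Measure.ext_of_charFun ?_
  ext t
  rw [charFun_apply, integral_map hm.aemeasurable (by fun_prop), charFun_multivariateGaussian hST]
  have h1 : ∀ z : Vec n × Vec m,
      Complex.exp ((inner ℝ (mulV L z.1 + mulV B z.2 + c) t : ℝ) * Complex.I) =
      Complex.exp ((inner ℝ c t : ℝ) * Complex.I) *
        (Complex.exp ((inner ℝ z.1 (mulV Lᵀ t) : ℝ) * Complex.I) *
        Complex.exp ((inner ℝ z.2 (mulV Bᵀ t) : ℝ) * Complex.I)) := fun z => by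
    rw [← Complex.exp_add, ← Complex.exp_add, inner_mulV, inner_mulV, Matrix.transpose_transpose,
      Matrix.transpose_transpose, inner_add_left, inner_add_left]
    push_cast
    ring_nf
  simp only [h1]
  rw [integral_const_mul, integral_prod_mul
    (fun x : Vec n => Complex.exp ((inner ℝ x (mulV Lᵀ t) : ℝ) * Complex.I))
    (fun x : Vec m => Complex.exp ((inner ℝ x (mulV Bᵀ t) : ℝ) * Complex.I)),
    ← charFun_apply, ← charFun_apply, charFun_multivariateGaussian hS,
    charFun_multivariateGaussian hT, ← Complex.exp_add, ← Complex.exp_add]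
  congr 1
  have e1 : t.ofLp ⬝ᵥ ((L * S * Lᵀ + B * T * Bᵀ) *ᵥ t.ofLp) =
      (mulV Lᵀ t).ofLp ⬝ᵥ (S *ᵥ (mulV Lᵀ t).ofLp) +
      (mulV Bᵀ t).ofLp ⬝ᵥ (T *ᵥ (mulV Bᵀ t).ofLp) := by
    simp only [mulV, Matrix.add_mulVec, dotProduct_add, ← Matrix.mulVec_mulVec]
    rw [dotProduct_mulVec_transpose L, dotProduct_mulVec_transpose B]
  have e2 : inner ℝ t (mulV L a + c) = inner ℝ (mulV Lᵀ t) a + inner ℝ c t := by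
    rw [inner_add_right, inner_mulV, real_inner_comm c t]
  rw [e1, e2, inner_zero_right]
  push_cast
  ring

end GaussianDensity

/-! ### Extended integrals of a nonnegative function plus an integrable one -/

section ExtendedIntegral

/-- The identity (a+b)⁺ - (a+b)⁻ = a + b⁺ - b⁻ without subtractions, so that it survives a = ∞ and
can be integrated in `ℝ≥0∞`. -/
theorem EReal.toENNReal_add_ofReal_neg (a : ℝ≥0∞) (b : ℝ) :
    ((a : EReal) + b).toENNReal + ENNReal.ofReal (-b) =
      a + ENNReal.ofReal b + (-((a : EReal) + b)).toENNReal ∧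
    (-((a : EReal) + b)).toENNReal ≤ ENNReal.ofReal (-b) := by
  induction a with
  | top => simp
  | coe r =>
    have h : ((r : ℝ≥0∞) : EReal) + b = (((r : ℝ) + b : ℝ) : EReal) := by
      push_cast; rfl
    have hr : (r : ℝ≥0∞) = ENNReal.ofReal r := by simp
    rw [h, ← EReal.coe_neg]
    simp only [EReal.toENNReal_of_ne_top (EReal.coe_ne_top _), EReal.toReal_coe]
    refine ⟨?_, ENNReal.ofReal_le_ofReal (by linarith [r.2])⟩
    rw [hr]
    have hm : ∀ x : ℝ, ENNReal.ofReal x = ENNReal.ofReal (max x 0) := fun x => by simp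
    have hmax : max ((r : ℝ) + b) 0 + max (-b) 0 = r + max b 0 + max (-(r + b)) 0 := by
      have := r.2
      rcases le_total b 0 with h1 | h1 <;> rcases le_total ((r : ℝ) + b) 0 with h2 | h2 <;>
        simp only [h1, h2, max_eq_left, max_eq_right, neg_nonneg, neg_nonpos] <;> ring
    rw [hm (r + b), hm (-b), hm b, hm (-(r + b)), ← ENNReal.ofReal_add (by simp) (by simp),
      ← ENNReal.ofReal_add (by simp) (by simp), ← ENNReal.ofReal_add (by positivity) (by simp),
      hmax]

theorem EReal.coe_sub_coe_eq_of_add_eq {p q A s t : ℝ≥0∞} (hq : q ≠ ⊤) (hs : s ≠ ⊤) (ht : t ≠ ⊤)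
    (h : p + t = A + s + q) :
    (p : EReal) - q = (A : EReal) + ((s.toReal - t.toReal : ℝ) : EReal) := by
  lift q to NNReal using hq
  lift s to NNReal using hs
  lift t to NNReal using ht
  induction A with
  | top =>
    have hp : p = ⊤ := by simpa using h
    subst hp
    have e : ((q : ℝ≥0∞) : EReal) = ((q : ℝ) : EReal) := rfl
    rw [e]
    simp only [EReal.coe_ennreal_top, EReal.top_sub_coe, EReal.top_add_coe]
  | coe r =>
    have hp : p ≠ ⊤ := fun hp => by
      rw [hp, top_add] at h
      exact ENNReal.coe_ne_top (r := r + s + q) (by push_cast; exact h.symm)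
    lift p to NNReal using hp
    have h' : (p : ℝ) + t = r + s + q := by exact_mod_cast h
    change (((p : ℝ) : EReal)) - ((q : ℝ) : EReal) = ((r : ℝ) : EReal) + (((s : ℝ) - t : ℝ) : EReal)
    rw [← EReal.coe_sub, ← EReal.coe_add]
    congr 1
    linarith

variable {Ω : Type*} [MeasurableSpace Ω] {μ : Measure Ω} {f : Ω → EReal} {a : Ω → ℝ≥0∞} {b : Ω → ℝ}

/-- The negative part of a + b is at most b⁻, hence has finite integral, and ∞ - ∞ never occurs. -/
theorem extIntegral_aux (ha : AEMeasurable a μ) (hb : Integrable b μ)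
    (hf : ∀ᵐ ω ∂μ, f ω = (a ω : EReal) + (b ω : EReal)) :
    ∫⁻ ω, (-f ω).toENNReal ∂μ ≠ ⊤ ∧
    ((∫⁻ ω, (f ω).toENNReal ∂μ : ℝ≥0∞) : EReal) - ((∫⁻ ω, (-f ω).toENNReal ∂μ : ℝ≥0∞) : EReal) =
      ((∫⁻ ω, a ω ∂μ : ℝ≥0∞) : EReal) + ((∫ ω, b ω ∂μ : ℝ) : EReal) := by
  have hbp : ∫⁻ ω, ENNReal.ofReal (b ω) ∂μ ≠ ⊤ := hb.lintegral_lt_top.ne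
  have hbm : ∫⁻ ω, ENNReal.ofReal (-b ω) ∂μ ≠ ⊤ := hb.neg.lintegral_lt_top.ne
  have hq : ∫⁻ ω, (-f ω).toENNReal ∂μ ≠ ⊤ := by
    refine ne_top_of_le_ne_top hbm (lintegral_mono_ae ?_)
    filter_upwards [hf] with ω hω
    rw [hω]
    exact (EReal.toENNReal_add_ofReal_neg _ _).2
  refine ⟨hq, ?_⟩
  rw [integral_eq_lintegral_pos_part_sub_lintegral_neg_part hb]
  refine EReal.coe_sub_coe_eq_of_add_eq hq hbp hbm ?_
  have hmb : AEMeasurable (fun ω => ENNReal.ofReal (b ω)) μ := hb.1.aemeasurable.ennreal_ofReal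
  have hmb' : AEMeasurable (fun ω => ENNReal.ofReal (-b ω)) μ :=
    hb.1.aemeasurable.neg.ennreal_ofReal
  have hab : AEMeasurable (fun ω => a ω + ENNReal.ofReal (b ω)) μ := ha.add hmb
  rw [← lintegral_add_left' ha, ← lintegral_add_right' _ hmb', ← lintegral_add_left' hab]
  refine lintegral_congr_ae ?_
  filter_upwards [hf] with ω hω
  rw [hω]
  exact (EReal.toENNReal_add_ofReal_neg _ _).1

theorem extIntegral_add (ha : AEMeasurable a μ) (hb : Integrable b μ)
    (hf : ∀ᵐ ω ∂μ, f ω = (a ω : EReal) + (b ω : EReal)) :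
    extIntegral μ f = ((∫⁻ ω, a ω ∂μ : ℝ≥0∞) : EReal) + ((∫ ω, b ω ∂μ : ℝ) : EReal) :=
  (extIntegral_aux ha hb hf).2

theorem extIntegral_neg_add (ha : AEMeasurable a μ) (hb : Integrable b μ)
    (hf : ∀ᵐ ω ∂μ, f ω = -((a ω : EReal) + (b ω : EReal))) :
    extIntegral μ f = -(((∫⁻ ω, a ω ∂μ : ℝ≥0∞) : EReal) + ((∫ ω, b ω ∂μ : ℝ) : EReal)) := by
  obtain ⟨h1, h2⟩ := extIntegral_aux (f := fun ω => -f ω) ha hb (by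
    filter_upwards [hf] with ω hω
    rw [hω, neg_neg])
  simp only [neg_neg] at h1 h2
  rw [← h2, EReal.neg_sub (Or.inr (by simp)) (Or.inr (by simpa using h1)), extIntegral, add_comm,
    sub_eq_add_neg]

end ExtendedIntegral

/-! ### Relative entropy and differential entropy -/

section RelativeEntropy

variable {m : ℕ}

/-- The relative entropy of the density `p` with respect to the density `q`. -/
noncomputable def relEntropy (p q : Vec m → ℝ) : ℝ≥0∞ :=
  ∫⁻ u, ENNReal.ofReal (q u * InformationTheory.klFun (p u / q u))

theorem relEntropy_self {q : Vec m → ℝ} (hq : ∀ u, 0 < q u) : relEntropy q q = 0 := by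
  simp [relEntropy, fun u => div_self (hq u).ne', InformationTheory.klFun_one]

theorem eq_ae_of_relEntropy_eq_zero {p q : Vec m → ℝ} (hp : Measurable p) (hp0 : ∀ u, 0 ≤ p u)
    (hq : Measurable q) (hq0 : ∀ u, 0 < q u) (h : relEntropy p q = 0) : p =ᵐ[volume] q := by
  have hm : Measurable fun u => ENNReal.ofReal (q u * InformationTheory.klFun (p u / q u)) :=
    (hq.mul (InformationTheory.measurable_klFun.comp (hp.div hq))).ennreal_ofReal
  rw [relEntropy, lintegral_eq_zero_iff hm] at h
  filter_upwards [h] with u hu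
  have hd : 0 ≤ p u / q u := div_nonneg (hp0 u) (hq0 u).le
  have h1 : q u * InformationTheory.klFun (p u / q u) = 0 :=
    le_antisymm (ENNReal.ofReal_eq_zero.1 hu)
      (mul_nonneg (hq0 u).le (InformationTheory.klFun_nonneg hd))
  have h2 := (mul_eq_zero.1 h1).resolve_left (hq0 u).ne'
  rw [InformationTheory.klFun_eq_zero_iff hd, div_eq_one_iff_eq (hq0 u).ne'] at h2
  exact h2

theorem integrable_of_lintegral_ofReal_eq_one {p : Vec m → ℝ} (hp : Measurable p)
    (h0 : ∀ u, 0 ≤ p u) (h1 : ∫⁻ u, ENNReal.ofReal (p u) = 1) :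
    Integrable p ∧ ∫ u, p u = 1 := by
  refine ⟨⟨hp.aestronglyMeasurable, ?_⟩, ?_⟩
  · rw [hasFiniteIntegral_iff_ofReal (Filter.Eventually.of_forall h0), h1]; simp
  · rw [integral_eq_lintegral_of_nonneg_ae (Filter.Eventually.of_forall h0)
      hp.aestronglyMeasurable, h1, ENNReal.toReal_one]

/-- Pointwise, p log p = q·klFun(p/q) + p log q + (p - q). The first term is nonnegative, so its
integral exists without assumptions, and p - q integrates to 0. -/
theorem entropy_eq_neg_relEntropy_add {p q : Vec m → ℝ} (hp : Measurable p) (hp0 : ∀ u, 0 ≤ p u)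
    (hp1 : ∫⁻ u, ENNReal.ofReal (p u) = 1) (hq : Measurable q) (hq0 : ∀ u, 0 < q u)
    (hq1 : ∫⁻ u, ENNReal.ofReal (q u) = 1)
    (hint : Integrable fun u => p u * Real.log (q u)) :
    entropy p = -((relEntropy p q : EReal) + ((∫ u, p u * Real.log (q u) : ℝ) : EReal)) := by
  obtain ⟨ip, ip1⟩ := integrable_of_lintegral_ofReal_eq_one hp hp0 hp1
  obtain ⟨iq, iq1⟩ := integrable_of_lintegral_ofReal_eq_one hq (fun u => (hq0 u).le) hq1
  have hm : Measurable fun u => ENNReal.ofReal (q u * InformationTheory.klFun (p u / q u)) :=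
    (hq.mul (InformationTheory.measurable_klFun.comp (hp.div hq))).ennreal_ofReal
  have h := extIntegral_neg_add (μ := volume)
    (f := fun u => ((-(p u * Real.log (p u)) : ℝ) : EReal))
    (b := fun u => p u * Real.log (q u) + (p u - q u)) hm.aemeasurable (hint.add (ip.sub iq))
    (Filter.Eventually.of_forall fun u => by
      have hd : 0 ≤ p u / q u := div_nonneg (hp0 u) (hq0 u).le
      rw [EReal.coe_ennreal_ofReal, max_eq_left (mul_nonneg (hq0 u).le
        (InformationTheory.klFun_nonneg hd)), ← EReal.coe_add, ← EReal.coe_neg]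
      congr 2
      rw [InformationTheory.klFun_apply]
      have hqne := (hq0 u).ne'
      rcases (hp0 u).eq_or_lt with h | h
      · rw [← h]; simp
      · rw [Real.log_div h.ne' hqne]; field_simp; ring)
  have hpq : ∫ u, (p u * Real.log (q u) + (p u - q u)) = ∫ u, p u * Real.log (q u) := by
    rw [integral_add hint (show Integrable fun u => p u - q u from ip.sub iq), integral_sub ip iq,
      ip1, iq1, sub_self, add_zero]
  rw [entropy, h, hpq]
  rfl

end RelativeEntropy

/-! ### Cost of a policy in terms of a reference policy -/

section Controlled

variable {n m N : ℕ} {A : ℕ → Mat n n} {B : ℕ → Mat n m} {ν₀ : Measure (Vec n)}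
  {π πs : ℕ → Vec n → Vec m → ℝ} {Ω : Type} [MeasurableSpace Ω] {P : Measure Ω}
  {x : ℕ → Ω → Vec n} {u : ℕ → Ω → Vec m}

theorem DensityControl.IsPolicy.measurable_density (hπ : IsPolicy N π) {k : ℕ} (hk : k < N)
    (y : Vec n) : Measurable (π k y) :=
  (hπ.measurable k hk).comp measurable_prodMk_left

/-- Disintegration of expectations along the policy. -/
theorem DensityControl.IsControlled.integrable_policy [IsProbabilityMeasure P]
    (hπ : IsPolicy N π) (hc : IsControlled N A B ν₀ π P x u) {k : ℕ} (hk : k < N)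
    {F : Vec n → Vec m → ℝ} (hF : Measurable fun z : Vec n × Vec m => F z.1 z.2)
    (hint : Integrable (fun ω => F (x k ω) (u k ω)) P) :
    (∀ᵐ ω ∂P, Integrable fun v => π k (x k ω) v * F (x k ω) v) ∧
    Integrable (fun ω => ∫ v, π k (x k ω) v * F (x k ω) v) P ∧
    ∫ ω, (∫ v, π k (x k ω) v * F (x k ω) v) ∂P = ∫ ω, F (x k ω) (u k ω) ∂P := by
  have hx := hc.measurable_state k hk.le
  have hu := hc.measurable_input k hk
  have hxu : Measurable fun ω => (x k ω, u k ω) := hx.prodMk hu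
  have hd : Measurable fun z : Vec n × Vec m => ENNReal.ofReal (π k z.1 z.2) :=
    (hπ.measurable k hk).ennreal_ofReal
  have hlt : ∀ᵐ z ∂((P.map (x k)).prod (volume : Measure (Vec m))),
      ENNReal.ofReal (π k z.1 z.2) < ⊤ := Filter.Eventually.of_forall fun z => ENNReal.ofReal_lt_top
  have hP : IsProbabilityMeasure (P.map (x k)) := Measure.isProbabilityMeasure_map hx.aemeasurable
  have h1 : Integrable (fun z : Vec n × Vec m => F z.1 z.2) (P.map fun ω => (x k ω, u k ω)) :=
    (integrable_map_measure hF.aestronglyMeasurable hxu.aemeasurable).2 hint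
  have h2 : ∫ ω, F (x k ω) (u k ω) ∂P =
      ∫ z, F z.1 z.2 ∂(P.map fun ω => (x k ω, u k ω)) :=
    (integral_map hxu.aemeasurable hF.aestronglyMeasurable).symm
  have hsm : ∀ z : Vec n × Vec m, (ENNReal.ofReal (π k z.1 z.2)).toReal • F z.1 z.2 =
      π k z.1 z.2 * F z.1 z.2 := fun z => by
    rw [ENNReal.toReal_ofReal (hπ.nonneg k hk _ _), smul_eq_mul]
  rw [hc.policy k hk, integrable_withDensity_iff_integrable_smul' hd hlt] at h1
  rw [hc.policy k hk, integral_withDensity_eq_integral_toReal_smul hd hlt] at h2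
  simp only [hsm] at h1 h2
  have h3 := h1.integral_prod_left
  refine ⟨ae_of_ae_map hx.aemeasurable h1.prod_right_ae,
    (integrable_map_measure h3.aestronglyMeasurable hx.aemeasurable).1 h3, ?_⟩
  rw [h2, integral_prod _ h1, integral_map hx.aemeasurable h3.aestronglyMeasurable]

theorem measurable_relEntropy {k : ℕ} (h1 : Measurable fun z : Vec n × Vec m => π k z.1 z.2)
    (h2 : Measurable fun z : Vec n × Vec m => πs k z.1 z.2) :
    Measurable fun y => relEntropy (π k y) (πs k y) := by
  have : Measurable fun z : Vec n × Vec m =>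
      ENNReal.ofReal (πs k z.1 z.2 * InformationTheory.klFun (π k z.1 z.2 / πs k z.1 z.2)) :=
    (h2.mul (InformationTheory.measurable_klFun.comp (h1.div h2))).ennreal_ofReal
  exact this.lintegral_prod_right'

/-- Infinite relative entropy means entropy -∞; since ε > 0, the stage cost is then +∞, in agreement
with the right side. -/
theorem EReal.coe_sub_mul_neg_add (ε r c : ℝ) (hε : 0 < ε) (K : ℝ≥0∞) :
    (r : EReal) - (ε : EReal) * (-((K : EReal) + (c : EReal))) =
      ((ENNReal.ofReal ε * K : ℝ≥0∞) : EReal) + ((r + ε * c : ℝ) : EReal) := by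
  induction K with
  | top =>
    have h1 : ENNReal.ofReal ε * ⊤ = ⊤ := ENNReal.mul_top (by simpa using hε)
    rw [h1, EReal.coe_ennreal_top, EReal.top_add_coe, EReal.top_add_coe, EReal.neg_top,
      EReal.coe_mul_bot_of_pos hε, sub_eq_add_neg, EReal.neg_bot, EReal.coe_add_top]
  | coe K =>
    have h1 : ((ENNReal.ofReal ε * (K : ℝ≥0∞) : ℝ≥0∞) : EReal) = ((ε * K : ℝ) : EReal) := by
      rw [EReal.coe_ennreal_mul, EReal.coe_ennreal_ofReal, max_eq_left hε.le, EReal.coe_mul]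
      rfl
    have h2 : ((K : ℝ≥0∞) : EReal) = ((K : ℝ) : EReal) := rfl
    rw [h1, h2, ← EReal.coe_add, ← EReal.coe_add, ← EReal.coe_neg, ← EReal.coe_mul,
      ← EReal.coe_sub]
    congr 1
    ring

theorem EReal.coe_ennreal_finset_sum {ι : Type*} (s : Finset ι) (f : ι → ℝ≥0∞) :
    ((∑ i ∈ s, f i : ℝ≥0∞) : EReal) = ∑ i ∈ s, (f i : EReal) := by
  induction s using Finset.cons_induction with
  | empty => simp
  | cons a s ha ih => rw [Finset.sum_cons, Finset.sum_cons, EReal.coe_ennreal_add, ih]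

theorem EReal.coe_real_finset_sum {ι : Type*} (s : Finset ι) (f : ι → ℝ) :
    ((∑ i ∈ s, f i : ℝ) : EReal) = ∑ i ∈ s, (f i : EReal) := by
  induction s using Finset.cons_induction with
  | empty => simp
  | cons a s ha ih => rw [Finset.sum_cons, Finset.sum_cons, EReal.coe_add, ih]

theorem memLp_input_of_energy_ne_top (hc : IsControlled N A B ν₀ π P x u)
    (hE : ∑ k ∈ Finset.range N, ∫⁻ ω, ‖u k ω‖ₑ ^ 2 ∂P ≠ ⊤) {k : ℕ} (hk : k < N) :
    MemLp (u k) 2 P := by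
  refine ⟨(hc.measurable_input k hk).aestronglyMeasurable, ?_⟩
  rw [eLpNorm_lt_top_iff_lintegral_rpow_enorm_lt_top (by simp) (by simp)]
  have := (ENNReal.sum_ne_top.1 hE) k (Finset.mem_range.2 hk)
  simpa [lt_top_iff_ne_top] using this

theorem energy_ne_top_of_memLp (h : ∀ k < N, MemLp (u k) 2 P) :
    ∑ k ∈ Finset.range N, ∫⁻ ω, ‖u k ω‖ₑ ^ 2 ∂P ≠ ⊤ := by
  refine ENNReal.sum_ne_top.2 fun k hk => ?_
  have := (h k (Finset.mem_range.1 hk)).2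
  rw [eLpNorm_lt_top_iff_lintegral_rpow_enorm_lt_top (by simp) (by simp)] at this
  simpa [lt_top_iff_ne_top] using this

theorem memLp_state (hc : IsControlled N A B ν₀ π P x u) (h0 : MemLp (x 0) 2 P)
    (h : ∀ k < N, MemLp (u k) 2 P) {k : ℕ} (hk : k ≤ N) : MemLp (x k) 2 P := by
  induction k with
  | zero => exact h0
  | succ k ih =>
    have h1 : MemLp (fun ω => mulV (A k) (x k ω) + mulV (B k) (u k ω)) 2 P :=
      ((mulVL (A k)).comp_memLp' (ih (by omega))).add ((mulVL (B k)).comp_memLp' (h k hk))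
    exact h1.ae_eq ((hc.system k hk).mono fun ω hω => hω.symm)

theorem memLp_two_of_map_eq_gaussian {X : Ω → Vec n} (hX : Measurable X) {a : Vec n} {S : Mat n n}
    (h : P.map X = multivariateGaussian a S) : MemLp X 2 P := by
  have := IsGaussian.memLp_two_id (μ := multivariateGaussian a S)
  rw [← h, memLp_map_measure_iff (by fun_prop) hX.aemeasurable] at this
  exact this

/-- The cost of a policy, relative to a reference policy. -/
theorem cost_eq_relEntropy_add [IsProbabilityMeasure P] {ε : ℝ} (hε : 0 < ε) (hπ : IsPolicy N π)
    (hπs : IsPolicy N πs) (hpos : ∀ k < N, ∀ y v, 0 < πs k y v)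
    (hc : IsControlled N A B ν₀ π P x u)
    (hE : ∑ k ∈ Finset.range N, ∫⁻ ω, ‖u k ω‖ₑ ^ 2 ∂P ≠ ⊤)
    (hlog : ∀ k < N, Integrable (fun ω => Real.log (πs k (x k ω) (u k ω))) P) :
    cost N ε π P x u =
      ((∑ k ∈ Finset.range N, ENNReal.ofReal ε *
        ∫⁻ ω, relEntropy (π k (x k ω)) (πs k (x k ω)) ∂P : ℝ≥0∞) : EReal) +
      ((∫ ω, ∑ k ∈ Finset.range N,
        ((1 / 2) * ‖u k ω‖ ^ 2 + ε * Real.log (πs k (x k ω) (u k ω))) ∂P : ℝ) : EReal) := by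
  have hdis := fun k (hk : k < N) => hc.integrable_policy hπ hk
    (F := fun y v => Real.log (πs k y v)) (hπs.measurable k hk).log (hlog k hk)
  have hmrel : ∀ k < N, Measurable fun ω => relEntropy (π k (x k ω)) (πs k (x k ω)) :=
    fun k hk => (measurable_relEntropy (hπ.measurable k hk) (hπs.measurable k hk)).comp
      (hc.measurable_state k hk.le)
  have hu2 : ∀ k < N, Integrable (fun ω => (1 / 2) * ‖u k ω‖ ^ 2) P := fun k hk =>
    ((memLp_input_of_energy_ne_top hc hE hk).integrable_norm_pow two_ne_zero).const_mul _
  have hb : ∀ k ∈ Finset.range N, Integrable (fun ω => (1 / 2) * ‖u k ω‖ ^ 2 +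
      ε * ∫ v, π k (x k ω) v * Real.log (πs k (x k ω) v)) P := fun k hk =>
    (hu2 k (Finset.mem_range.1 hk)).add ((hdis k (Finset.mem_range.1 hk)).2.1.const_mul _)
  have hb' : ∀ k ∈ Finset.range N, Integrable (fun ω => (1 / 2) * ‖u k ω‖ ^ 2 +
      ε * Real.log (πs k (x k ω) (u k ω))) P := fun k hk =>
    (hu2 k (Finset.mem_range.1 hk)).add ((hlog k (Finset.mem_range.1 hk)).const_mul _)
  have hA : ∀ k ∈ Finset.range N, Measurable fun ω =>
      ENNReal.ofReal ε * relEntropy (π k (x k ω)) (πs k (x k ω)) := fun k hk =>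
    (hmrel k (Finset.mem_range.1 hk)).const_mul _
  -- The relative entropies form the nonnegative, possibly infinite part. The rest is integrable,
  -- and disintegration replaces its conditional mean of log π* by log π*(u_k|x_k).
  rw [cost, if_neg hE, extIntegral_add
    (a := fun ω => ∑ k ∈ Finset.range N,
      ENNReal.ofReal ε * relEntropy (π k (x k ω)) (πs k (x k ω)))
    (b := fun ω => ∑ k ∈ Finset.range N, ((1 / 2) * ‖u k ω‖ ^ 2 +
      ε * ∫ v, π k (x k ω) v * Real.log (πs k (x k ω) v)))
    (Finset.measurable_fun_sum _ hA).aemeasurable (integrable_finsetSum _ hb)]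
  · congr 2
    · rw [lintegral_finsetSum _ hA]
      exact Finset.sum_congr rfl fun k hk =>
        lintegral_const_mul _ (hmrel k (Finset.mem_range.1 hk))
    · rw [integral_finsetSum _ hb, integral_finsetSum _ hb']
      refine Finset.sum_congr rfl fun k hk => ?_
      have hk := Finset.mem_range.1 hk
      rw [integral_add (hu2 k hk) ((hdis k hk).2.1.const_mul _),
        integral_add (hu2 k hk) ((hlog k hk).const_mul _)]
      simp only [integral_const_mul, (hdis k hk).2.2]
  · have hall : ∀ᵐ ω ∂P, ∀ k ∈ Finset.range N,
        Integrable fun v => π k (x k ω) v * Real.log (πs k (x k ω) v) := by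
      rw [Filter.eventually_all_finset]
      exact fun k hk => (hdis k (Finset.mem_range.1 hk)).1
    filter_upwards [hall] with ω hω
    rw [EReal.coe_ennreal_finset_sum, EReal.coe_real_finset_sum, ← Finset.sum_add_distrib]
    refine Finset.sum_congr rfl fun k hk => ?_
    have hk' := Finset.mem_range.1 hk
    rw [entropy_eq_neg_relEntropy_add
      (hπ.measurable_density hk' _)
      (hπ.nonneg k hk' _) (hπ.lintegral_eq_one k hk' _)
      (hπs.measurable_density hk' _)
      (hpos k hk' _) (hπs.lintegral_eq_one k hk' _) (hω k hk),
      EReal.coe_sub_mul_neg_add _ _ _ hε]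

end Controlled

/-! ### Construction of controlled processes -/

section Existence

variable {n m : ℕ} {A : ℕ → Mat n n} {B : ℕ → Mat n m} {ν₀ : Measure (Vec n)}
  {π : ℕ → Vec n → Vec m → ℝ} {N : ℕ}

/-- Every policy can be applied, from every initial law. -/
theorem exists_isControlled [IsProbabilityMeasure ν₀] (hπ : IsPolicy N π) :
    ∃ (Ω : Type) (_ : MeasurableSpace Ω) (P : Measure Ω)
      (x : ℕ → Ω → Vec n) (u : ℕ → Ω → Vec m),
      IsProbabilityMeasure P ∧ IsControlled N A B ν₀ π P x u := by
  induction N with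
  | zero =>
    refine ⟨Vec n, inferInstance, ν₀, fun _ => id, fun _ _ => 0, inferInstance, ?_⟩
    exact ⟨fun _ _ => measurable_id, fun _ h => absurd h (Nat.not_lt_zero _), Measure.map_id,
      fun _ h => absurd h (Nat.not_lt_zero _), fun _ h => absurd h (Nat.not_lt_zero _)⟩
  | succ K ih =>
    obtain ⟨Ω, mΩ, P, x, u, hP, hc⟩ := ih ⟨fun k hk => hπ.measurable k (by omega),
      fun k hk => hπ.nonneg k (by omega), fun k hk => hπ.lintegral_eq_one k (by omega)⟩
    have hxK := hc.measurable_state K le_rfl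
    have hd0 := (hπ.measurable K (Nat.lt_succ_self K)).ennreal_ofReal
    have hd : Measurable fun z : Ω × Vec m => ENNReal.ofReal (π K (x K z.1) z.2) :=
      hd0.comp ((hxK.comp measurable_fst).prodMk measurable_snd)
    -- The last input is adjoined as a new coordinate, with conditional density π_K(·|x_K).
    set P' : Measure (Ω × Vec m) :=
      (P.prod volume).withDensity fun z => ENNReal.ofReal (π K (x K z.1) z.2) with hP'
    have hlint : ∀ g : Ω × Vec m → ℝ≥0∞, Measurable g → ∫⁻ z, g z ∂P' =
        ∫⁻ ω, (∫⁻ v, ENNReal.ofReal (π K (x K ω) v) * g (ω, v)) ∂P := fun g hg => by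
      rw [hP', lintegral_withDensity_eq_lintegral_mul _ hd hg,
        lintegral_prod _ (hd.mul hg).aemeasurable]
      rfl
    -- As π_K(·|x) has mass 1, the first marginal is unchanged, and all earlier properties carry
    -- over.
    have hfst : P'.map Prod.fst = P := by
      refine Measure.ext_of_lintegral _ fun g hg => ?_
      rw [lintegral_map hg measurable_fst,
        hlint (fun z => g z.1) (hg.comp measurable_fst)]
      refine lintegral_congr fun ω => ?_
      have hm : Measurable fun v => ENNReal.ofReal (π K (x K ω) v) :=
        (hπ.measurable_density (Nat.lt_succ_self K) _).ennreal_ofReal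
      change ∫⁻ v, ENNReal.ofReal (π K (x K ω) v) * g ω = g ω
      rw [lintegral_mul_const _ hm, hπ.lintegral_eq_one K (Nat.lt_succ_self K), one_mul]
    have hmapfst : ∀ {γ : Type} [MeasurableSpace γ] {g : Ω → γ}, Measurable g →
        P'.map (fun z => g z.1) = P.map g := fun {γ} _ {g} hg => by
      rw [← hfst, Measure.map_map hg measurable_fst]; rfl
    have hprob : IsProbabilityMeasure P' := ⟨by
      rw [← Set.preimage_univ (f := Prod.fst), ← Measure.map_apply measurable_fst
        MeasurableSet.univ, hfst, measure_univ]⟩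
    let x' : ℕ → Ω × Vec m → Vec n := fun k z =>
      if k ≤ K then x k z.1 else mulV (A K) (x K z.1) + mulV (B K) z.2
    let u' : ℕ → Ω × Vec m → Vec m := fun k z => if k < K then u k z.1 else z.2
    have hx'le : ∀ k ≤ K, x' k = fun z => x k z.1 := fun k hk => by
      funext z; simp only [x', if_pos hk]
    have hx'succ : x' (K + 1) = fun z => mulV (A K) (x K z.1) + mulV (B K) z.2 := by
      funext z; simp [x']
    have hu'lt : ∀ k < K, u' k = fun z => u k z.1 := fun k hk => by
      funext z; simp only [u', if_pos hk]
    have hu'K : u' K = fun z => z.2 := by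
      funext z; simp [u']
    have hmK : Measurable fun z : Ω × Vec m => x K z.1 := hxK.comp measurable_fst
    refine ⟨Ω × Vec m, inferInstance, P', x', u', hprob, ?_, ?_, ?_, ?_, ?_⟩
    · intro k hk
      rcases Nat.lt_or_ge K k with h | h
      · obtain rfl : k = K + 1 := by omega
        rw [hx'succ]
        exact ((measurable_mulV _).comp hmK).add ((measurable_mulV _).comp measurable_snd)
      · rw [hx'le k h]; exact (hc.measurable_state k h).comp measurable_fst
    · intro k hk
      rcases Nat.lt_or_ge k K with h | h
      · rw [hu'lt k h]; exact (hc.measurable_input k h).comp measurable_fst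
      · obtain rfl : k = K := by omega
        rw [hu'K]; exact measurable_snd
    · rw [hx'le 0 (Nat.zero_le _), hmapfst (hc.measurable_state 0 (Nat.zero_le _)), hc.initial]
    · intro k hk
      rcases Nat.lt_or_ge k K with h | h
      · rw [hx'le (k + 1) h, hx'le k h.le, hu'lt k h]
        have := hc.system k h
        rw [← hfst] at this
        exact ae_of_ae_map measurable_fst.aemeasurable this
      · obtain rfl : k = K := by omega
        rw [hx'succ, hx'le k le_rfl, hu'K]
        exact Filter.Eventually.of_forall fun _ => rfl
    · intro k hk
      rcases Nat.lt_or_ge k K with h | h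
      · rw [hx'le k h.le, hu'lt k h, hmapfst (hc.measurable_state k h.le),
          hmapfst ((hc.measurable_state k h.le).prodMk (hc.measurable_input k h)), hc.policy k h]
      · obtain rfl : k = K := by omega
        rw [hx'le k le_rfl, hu'K, hmapfst hxK]
        refine Measure.ext_of_lintegral _ fun g hg => ?_
        have hpm : Measurable fun z : Ω × Vec m => (x k z.1, z.2) := hmK.prodMk measurable_snd
        rw [lintegral_map hg hpm, hlint (fun z => g (x k z.1, z.2)) (hg.comp hpm),
          lintegral_withDensity_eq_lintegral_mul _ hd0 hg,
          lintegral_prod _ (hd0.mul hg).aemeasurable,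
          lintegral_map (hd0.mul hg).lintegral_prod_right' hxK]
        rfl

end Existence

/-! ### State and input laws under the Gaussian policy -/

section GaussianPolicy

variable {n m : ℕ} {N : ℕ} {A : ℕ → Mat n n} {B : ℕ → Mat n m} {ε : ℝ} {mu₀ muN : Vec n}
  {Q Sig : ℕ → Mat n n}

/-- The mean of the input under the linear Gaussian policy, as a function of the state. -/
noncomputable def policyMean (N : ℕ) (A : ℕ → Mat n n) (B : ℕ → Mat n m) (mu₀ muN : Vec n)
    (Q : ℕ → Mat n n) (k : ℕ) (y : Vec n) : Vec m :=
  -mulV (feedbackGain (A k) (B k) (Q (k + 1))) (y - meanState N A B mu₀ muN k) +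
    meanInput N A B mu₀ muN k

/-- The linear Gaussian policy associated with the solution `Q` of the Riccati recursion. -/
noncomputable def gaussPolicy (N : ℕ) (A : ℕ → Mat n n) (B : ℕ → Mat n m) (ε : ℝ)
    (mu₀ muN : Vec n) (Q : ℕ → Mat n n) (k : ℕ) (y : Vec n) (v : Vec m) : ℝ :=
  gaussDensity (policyMean N A B mu₀ muN Q k y) (ε • (1 + (B k)ᵀ * (Q (k + 1))⁻¹ * B k)⁻¹) v

theorem measurable_policyMean (k : ℕ) : Measurable (policyMean N A B mu₀ muN Q k) := by
  have : Measurable fun y => mulV (feedbackGain (A k) (B k) (Q (k + 1)))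
      (y - meanState N A B mu₀ muN k) :=
    (measurable_mulV _).comp (measurable_id.sub_const _)
  exact this.neg.add_const _

theorem policyCovariance_posDef (hε : 0 < ε) (hric : IsRiccatiSolution N A B Q) {k : ℕ}
    (hk : k < N) : (ε • (1 + (B k)ᵀ * (Q (k + 1))⁻¹ * B k)⁻¹).PosDef :=
  (hric.posDef k hk).inv.smul hε

theorem isPolicy_gaussPolicy (hε : 0 < ε) (hric : IsRiccatiSolution N A B Q) :
    IsPolicy N (gaussPolicy N A B ε mu₀ muN Q) where
  measurable k _ := measurable_gaussDensity _ ((measurable_policyMean k).comp measurable_fst)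
    measurable_snd
  nonneg _ hk _ _ := (gaussDensity_pos (policyCovariance_posDef hε hric hk) _ _).le
  lintegral_eq_one _ hk _ := lintegral_gaussDensity _ (policyCovariance_posDef hε hric hk)

variable {ν₀ : Measure (Vec n)} {π : ℕ → Vec n → Vec m → ℝ} {Ω : Type} [MeasurableSpace Ω]
  {P : Measure Ω} {x : ℕ → Ω → Vec n} {u : ℕ → Ω → Vec m}

/-- The joint law of state and input under a policy that agrees with the Gaussian one. -/
theorem map_state_input_eq [IsProbabilityMeasure P] (hε : 0 < ε)
    (hric : IsRiccatiSolution N A B Q) (hπ : IsPolicy N π)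
    (hc : IsControlled N A B ν₀ π P x u) {k : ℕ} (hk : k < N)
    (hae : ∀ᵐ y ∂(P.map (x k)), π k y =ᵐ[volume] gaussPolicy N A B ε mu₀ muN Q k y) :
    P.map (fun ω => (x k ω, u k ω)) =
      ((P.map (x k)).prod (multivariateGaussian 0
        (ε • (1 + (B k)ᵀ * (Q (k + 1))⁻¹ * B k)⁻¹))).map
        fun z => (z.1, policyMean N A B mu₀ muN Q k z.1 + z.2) := by
  have hP : IsProbabilityMeasure (P.map (x k)) :=
    Measure.isProbabilityMeasure_map (hc.measurable_state k hk.le).aemeasurable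
  rw [hc.policy k hk, ← withDensity_gaussDensity_eq_map _ (measurable_policyMean k)
    (policyCovariance_posDef hε hric hk)]
  refine withDensity_congr_ae ?_
  have hset : MeasurableSet {z : Vec n × Vec m |
      π k z.1 z.2 = gaussPolicy N A B ε mu₀ muN Q k z.1 z.2} :=
    measurableSet_eq_fun (hπ.measurable k hk)
      ((isPolicy_gaussPolicy hε hric).measurable k hk)
  have h := (Measure.ae_prod_iff_ae_ae (μ := P.map (x k)) (ν := (volume : Measure (Vec m)))
    hset).2 hae
  filter_upwards [h] with z hz
  rw [hz]; rfl

/-- Agreement with the Gaussian policy is asked only almost everywhere for the law of x_k, so that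
the lemma also covers a competing optimal policy in the uniqueness proof. -/
theorem map_state_succ_eq [IsProbabilityMeasure P] (hε : 0 < ε)
    (hric : IsRiccatiSolution N A B Q) (hcov : IsClosedLoopCovariance N A B ε Q Sig)
    (hπ : IsPolicy N π) (hc : IsControlled N A B ν₀ π P x u) {k : ℕ} (hk : k < N)
    (hlaw : P.map (x k) = multivariateGaussian (meanState N A B mu₀ muN k) (Sig k))
    (hae : ∀ᵐ y ∂(P.map (x k)), π k y =ᵐ[volume] gaussPolicy N A B ε mu₀ muN Q k y) :
    P.map (x (k + 1)) = multivariateGaussian (meanState N A B mu₀ muN (k + 1)) (Sig (k + 1)) := by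
  have hxu : Measurable fun ω => (x k ω, u k ω) :=
    (hc.measurable_state k hk.le).prodMk (hc.measurable_input k hk)
  have hsys : Measurable fun z : Vec n × Vec m => mulV (A k) z.1 + mulV (B k) z.2 := by fun_prop
  have hsh : Measurable fun z : Vec n × Vec m =>
      (z.1, policyMean N A B mu₀ muN Q k z.1 + z.2) :=
    measurable_fst.prodMk (((measurable_policyMean k).comp measurable_fst).add measurable_snd)
  set K := feedbackGain (A k) (B k) (Q (k + 1)) with hK
  set μ := meanState N A B mu₀ muN k with hμ
  have h1 : P.map (x (k + 1)) =
      (P.map fun ω => (x k ω, u k ω)).map fun z => mulV (A k) z.1 + mulV (B k) z.2 := by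
    rw [Measure.map_map hsys hxu]
    exact Measure.map_congr (hc.system k hk)
  rw [h1, map_state_input_eq hε hric hπ hc hk hae, Measure.map_map hsys hsh, hlaw]
  have h2 : ((fun z : Vec n × Vec m => mulV (A k) z.1 + mulV (B k) z.2) ∘
      fun z : Vec n × Vec m => (z.1, policyMean N A B mu₀ muN Q k z.1 + z.2)) =
      fun z : Vec n × Vec m => mulV (A k - B k * K) z.1 + mulV (B k) z.2 +
        mulV (B k) (mulV K μ + meanInput N A B mu₀ muN k) := by
    funext z
    simp only [Function.comp_apply, policyMean, ← hK, ← hμ, mulV_add, mulV_sub, sub_mulV,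
      mulV_mulV, neg_sub]
    abel
  rw [h2, map_affine_prod_multivariateGaussian _ _ (hcov.posDef k hk.le).posSemidef
    (policyCovariance_posDef hε hric hk).posSemidef, ← hcov.step k hk, meanState_succ]
  congr 1
  simp only [mulV_add, sub_mulV, mulV_mulV, ← hμ]
  abel

theorem map_state_eq [IsProbabilityMeasure P] (hε : 0 < ε)
    (hric : IsRiccatiSolution N A B Q) (hcov : IsClosedLoopCovariance N A B ε Q Sig)
    (hc : IsControlled N A B (multivariateGaussian mu₀ (Sig 0))
      (gaussPolicy N A B ε mu₀ muN Q) P x u) {k : ℕ} (hk : k ≤ N) :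
    P.map (x k) = multivariateGaussian (meanState N A B mu₀ muN k) (Sig k) := by
  induction k with
  | zero => rw [hc.initial, meanState_eq_detState]; rfl
  | succ k ih =>
    exact map_state_succ_eq hε hric hcov (isPolicy_gaussPolicy hε hric) hc hk (ih (by omega))
      (Filter.Eventually.of_forall fun _ => Filter.EventuallyEq.rfl)

theorem memLp_policyMean {X : Type*} [MeasurableSpace X] {μ : Measure X} [IsFiniteMeasure μ]
    {f : X → Vec n} (hf : MemLp f 2 μ) (k : ℕ) :
    MemLp (fun ω => policyMean N A B mu₀ muN Q k (f ω)) 2 μ := by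
  have h : MemLp (fun ω => f ω - meanState N A B mu₀ muN k) 2 μ := hf.sub (memLp_const _)
  exact ((mulVL (feedbackGain (A k) (B k) (Q (k + 1)))).comp_memLp' h).neg.add (memLp_const _)

theorem memLp_input_gaussPolicy [IsProbabilityMeasure P] (hε : 0 < ε)
    (hric : IsRiccatiSolution N A B Q) (hcov : IsClosedLoopCovariance N A B ε Q Sig)
    (hc : IsControlled N A B (multivariateGaussian mu₀ (Sig 0))
      (gaussPolicy N A B ε mu₀ muN Q) P x u) {k : ℕ} (hk : k < N) :
    MemLp (u k) 2 P := by
  have hxu : Measurable fun ω => (x k ω, u k ω) :=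
    (hc.measurable_state k hk.le).prodMk (hc.measurable_input k hk)
  have hsh : Measurable fun z : Vec n × Vec m =>
      (z.1, policyMean N A B mu₀ muN Q k z.1 + z.2) :=
    measurable_fst.prodMk (((measurable_policyMean k).comp measurable_fst).add measurable_snd)
  have h : MemLp (Prod.snd : Vec n × Vec m → Vec m) 2 (P.map fun ω => (x k ω, u k ω)) := by
    rw [map_state_input_eq hε hric (isPolicy_gaussPolicy hε hric) hc hk
      (Filter.Eventually.of_forall fun _ => Filter.EventuallyEq.rfl),
      map_state_eq hε hric hcov hc hk.le,
      memLp_map_measure_iff measurable_snd.aestronglyMeasurable hsh.aemeasurable]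
    have h1 : MemLp (fun y : Vec n => policyMean N A B mu₀ muN Q k y) 2
        (multivariateGaussian (meanState N A B mu₀ muN k) (Sig k)) :=
      memLp_policyMean IsGaussian.memLp_two_id k
    have h2 : MemLp (id : Vec m → Vec m) 2 (multivariateGaussian 0
        (ε • (1 + (B k)ᵀ * (Q (k + 1))⁻¹ * B k)⁻¹)) := IsGaussian.memLp_two_id
    exact (h1.comp_fst _).add (h2.comp_snd _)
  exact (memLp_map_measure_iff measurable_snd.aestronglyMeasurable hxu.aemeasurable).1 h

end GaussianPolicy

/-! ### The verification argument -/

section Verification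

variable {n m : ℕ} {N : ℕ} {A : ℕ → Mat n n} {B : ℕ → Mat n m} {ε : ℝ} {mu₀ muN : Vec n}
  {Q Sig : ℕ → Mat n n}

/-- The potential whose differences along trajectories measure the cost of the
Gaussian policy. -/
noncomputable def potential (N : ℕ) (A : ℕ → Mat n n) (B : ℕ → Mat n m) (mu₀ muN : Vec n)
    (Q : ℕ → Mat n n) (k : ℕ) (y : Vec n) : ℝ :=
  (1 / 2) * inner ℝ (y - meanState N A B mu₀ muN k)
      (mulV (Q k)⁻¹ (y - meanState N A B mu₀ muN k)) -
    inner ℝ (costate N A B mu₀ muN) (mulV (Phi A N k) (y - meanState N A B mu₀ muN k))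

/-- The deterministic part of the stage cost. -/
noncomputable def stageConst (N : ℕ) (A : ℕ → Mat n n) (B : ℕ → Mat n m) (ε : ℝ)
    (mu₀ muN : Vec n) (Q : ℕ → Mat n n) (k : ℕ) : ℝ :=
  (1 / 2) * ‖meanInput N A B mu₀ muN k‖ ^ 2 - ε * Real.log (Real.sqrt ((2 * Real.pi) ^ m *
    (ε • (1 + (B k)ᵀ * (Q (k + 1))⁻¹ * B k)⁻¹).det))

theorem log_gaussDensity {S : Mat m m} (hS : S.PosDef) (a v : Vec m) :
    Real.log (gaussDensity a S v) = -Real.log (Real.sqrt ((2 * Real.pi) ^ m * S.det)) -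
      (1 / 2) * inner ℝ (v - a) (mulV S⁻¹ (v - a)) := by
  have h := hS.det_pos
  have hpi := Real.pi_pos
  rw [gaussDensity_eq, Real.log_mul (by positivity) (Real.exp_pos _).ne', Real.log_exp,
    Real.log_inv]
  ring

/-- The quadratic part, in deviations from the mean trajectory, is `riccati_completeSquare`; the
square is exactly the exponent of the Gaussian density, scaled by ε. -/
theorem stageCost_eq (hε : 0 < ε) (hric : IsRiccatiSolution N A B Q) {k : ℕ} (hk : k < N)
    (y : Vec n) (v : Vec m) :
    (1 / 2) * ‖v‖ ^ 2 + ε * Real.log (gaussPolicy N A B ε mu₀ muN Q k y v) =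
      stageConst N A B ε mu₀ muN Q k + (potential N A B mu₀ muN Q k y -
        potential N A B mu₀ muN Q (k + 1) (mulV (A k) y + mulV (B k) v)) := by
  have hW := hric.posDef k hk
  have dW := (Matrix.isUnit_iff_isUnit_det _).1 hW.isUnit
  set W := 1 + (B k)ᵀ * (Q (k + 1))⁻¹ * B k with hWdef
  set b := meanInput N A B mu₀ muN k with hb
  set d := y - meanState N A B mu₀ muN k with hd
  set w := v - b with hw
  have hnext : mulV (A k) y + mulV (B k) v - meanState N A B mu₀ muN (k + 1) =
      mulV (A k) d + mulV (B k) w := by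
    rw [meanState_succ, hd, hw, mulV_sub, mulV_sub]; abel
  have hdev : v - policyMean N A B mu₀ muN Q k y =
      w + mulV (feedbackGain (A k) (B k) (Q (k + 1))) d := by
    rw [policyMean, ← hb, ← hd, hw]; abel
  have hinv : (ε • W⁻¹)⁻¹ = ε⁻¹ • W := by
    rw [Matrix.inv_eq_left_inv]
    rw [Matrix.smul_mul, Matrix.mul_smul, smul_smul, inv_mul_cancel₀ hε.ne', one_smul,
      Matrix.mul_nonsing_inv _ dW]
  have hsmul : ∀ z : Vec m, mulV (ε⁻¹ • W) z = ε⁻¹ • mulV W z := fun z => by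
    simp [mulV, Matrix.smul_mulVec]
  have hlog : ε * Real.log (gaussPolicy N A B ε mu₀ muN Q k y v) =
      -(ε * Real.log (Real.sqrt ((2 * Real.pi) ^ m * (ε • W⁻¹).det))) -
      (1 / 2) * inner ℝ (w + mulV (feedbackGain (A k) (B k) (Q (k + 1))) d)
        (mulV W (w + mulV (feedbackGain (A k) (B k) (Q (k + 1))) d)) := by
    have hS : (ε • W⁻¹).PosDef := policyCovariance_posDef hε hric hk
    rw [gaussPolicy, ← hWdef, log_gaussDensity hS, hdev, hinv, hsmul,
      inner_smul_right]
    field_simp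
  have hsq := riccati_completeSquare (hric.isUnit k hk.le) (hric.isUnit_state k hk)
    (hric.isUnit (k + 1) hk) (hric.isSymm (k + 1) hk) (hric.step k) hW.isUnit d.ofLp w.ofLp
  have hsq' : inner ℝ w w + inner ℝ (mulV (A k) d + mulV (B k) w)
      (mulV (Q (k + 1))⁻¹ (mulV (A k) d + mulV (B k) w)) = inner ℝ d (mulV (Q k)⁻¹ d) +
      inner ℝ (w + mulV (feedbackGain (A k) (B k) (Q (k + 1))) d)
        (mulV W (w + mulV (feedbackGain (A k) (B k) (Q (k + 1))) d)) := by
    simp only [inner_eq_dotProduct]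
    exact hsq
  -- The cross term of ‖b + w‖² is a difference along the dynamics too, because b is the costate
  -- pulled back by Φ(N,k+1)B_k. This is what the linear term of the potential is for.
  have hlin : inner ℝ b w = inner ℝ (costate N A B mu₀ muN)
        (mulV (Phi A N (k + 1)) (mulV (A k) d + mulV (B k) w)) -
      inner ℝ (costate N A B mu₀ muN) (mulV (Phi A N k) d) := by
    rw [hb, meanInput_eq, ← inner_mulV, mulV_add, mulV_mulV, mulV_mulV, ← Phi_pred hk,
      inner_add_right]
    ring
  have hnorm : ‖v‖ ^ 2 = ‖b‖ ^ 2 + 2 * inner ℝ b w + inner ℝ w w := by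
    have := norm_add_sq_real b w
    rw [hw, add_sub_cancel] at this
    rw [this, ← hw, real_inner_self_eq_norm_sq]
  rw [potential, potential, hnext, ← hd, stageConst, ← hb, ← hWdef, hlog, hnorm]
  linarith

variable {ν₀ : Measure (Vec n)} {π : ℕ → Vec n → Vec m → ℝ} {Ω : Type} [MeasurableSpace Ω]
  {P : Measure Ω} {x : ℕ → Ω → Vec n} {u : ℕ → Ω → Vec m}

theorem MeasureTheory.MemLp.integrable_inner_mulV {p q : ℕ} {X : Ω → Vec p} {Y : Ω → Vec q}
    (hX : MemLp X 2 P) (hY : MemLp Y 2 P) (M : Mat p q) :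
    Integrable (fun ω => (inner ℝ (X ω) (mulV M (Y ω)) : ℝ)) P := by
  have hY' : MemLp (fun ω => mulV M (Y ω)) 2 P := (mulVL M).comp_memLp' hY
  refine (hX.norm.integrable_mul hY'.norm).mono (hX.1.inner hY'.1)
    (Filter.Eventually.of_forall fun ω => ?_)
  simpa using abs_real_inner_le_norm (X ω) (mulV M (Y ω))

theorem integrable_potential [IsFiniteMeasure P] {X : Ω → Vec n} (hX : MemLp X 2 P) (k : ℕ) :
    Integrable (fun ω => potential N A B mu₀ muN Q k (X ω)) P := by
  have h : MemLp (fun ω => X ω - meanState N A B mu₀ muN k) 2 P := hX.sub (memLp_const _)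
  exact ((h.integrable_inner_mulV h _).const_mul _).sub
    ((memLp_const (costate N A B mu₀ muN)).integrable_inner_mulV h _)

theorem measurable_potential (k : ℕ) : Measurable (potential N A B mu₀ muN Q k) := by
  have h : Measurable fun y : Vec n => y - meanState N A B mu₀ muN k := measurable_id.sub_const _
  have h1 : Measurable fun y : Vec n => (inner ℝ (y - meanState N A B mu₀ muN k)
      (mulV (Q k)⁻¹ (y - meanState N A B mu₀ muN k)) : ℝ) :=
    h.inner ((measurable_mulV _).comp h)
  have h2 : Measurable fun y : Vec n => (inner ℝ (costate N A B mu₀ muN)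
      (mulV (Phi A N k) (y - meanState N A B mu₀ muN k)) : ℝ) :=
    measurable_const.inner ((measurable_mulV _).comp h)
  exact (h1.const_mul _).sub h2

/-- The minimal cost of steering from the law `ν₀` to the law `νN`. -/
noncomputable def optimalCost (N : ℕ) (A : ℕ → Mat n n) (B : ℕ → Mat n m) (ε : ℝ)
    (mu₀ muN : Vec n) (Q : ℕ → Mat n n) (ν₀ νN : Measure (Vec n)) : ℝ :=
  ∑ k ∈ Finset.range N, stageConst N A B ε mu₀ muN Q k +
    ((∫ y, potential N A B mu₀ muN Q 0 y ∂ν₀) - ∫ y, potential N A B mu₀ muN Q N y ∂νN)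

/-- The potentials telescope along trajectories, leaving only the laws at times 0 and N. Finite
energy gives square-integrable states, hence integrable potentials. -/
theorem cost_eq_relEntropy_add_optimalCost [IsProbabilityMeasure P] (hε : 0 < ε)
    (hric : IsRiccatiSolution N A B Q) (hπ : IsPolicy N π)
    (hc : IsControlled N A B ν₀ π P x u) (h0 : MemLp (x 0) 2 P)
    (hE : ∑ k ∈ Finset.range N, ∫⁻ ω, ‖u k ω‖ₑ ^ 2 ∂P ≠ ⊤) :
    cost N ε π P x u =
      ((∑ k ∈ Finset.range N, ENNReal.ofReal ε * ∫⁻ ω, relEntropy (π k (x k ω))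
        (gaussPolicy N A B ε mu₀ muN Q k (x k ω)) ∂P : ℝ≥0∞) : EReal) +
      (optimalCost N A B ε mu₀ muN Q ν₀ (P.map (x N)) : EReal) := by
  have hu : ∀ k < N, MemLp (u k) 2 P := fun k hk => memLp_input_of_energy_ne_top hc hE hk
  have hx : ∀ k ≤ N, MemLp (x k) 2 P := fun k hk => memLp_state hc h0 hu hk
  have hlog : ∀ k < N, Integrable
      (fun ω => Real.log (gaussPolicy N A B ε mu₀ muN Q k (x k ω) (u k ω))) P := fun k hk => by
    simp only [gaussPolicy, log_gaussDensity (policyCovariance_posDef hε hric hk)]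
    have h : MemLp (fun ω => u k ω - policyMean N A B mu₀ muN Q k (x k ω)) 2 P :=
      (hu k hk).sub (memLp_policyMean (hx k hk.le) k)
    exact (integrable_const _).sub ((h.integrable_inner_mulV h _).const_mul _)
  rw [cost_eq_relEntropy_add hε hπ (isPolicy_gaussPolicy (mu₀ := mu₀) (muN := muN) hε hric)
    (fun k hk y v => gaussDensity_pos (policyCovariance_posDef hε hric hk) _ _) hc hE hlog]
  congr 2
  have hae : (fun ω => ∑ k ∈ Finset.range N, ((1 / 2) * ‖u k ω‖ ^ 2 +
      ε * Real.log (gaussPolicy N A B ε mu₀ muN Q k (x k ω) (u k ω)))) =ᵐ[P]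
      fun ω => ∑ k ∈ Finset.range N, stageConst N A B ε mu₀ muN Q k +
        (potential N A B mu₀ muN Q 0 (x 0 ω) - potential N A B mu₀ muN Q N (x N ω)) := by
    have hall : ∀ᵐ ω ∂P, ∀ k ∈ Finset.range N,
        x (k + 1) ω = mulV (A k) (x k ω) + mulV (B k) (u k ω) := by
      rw [Filter.eventually_all_finset]
      exact fun k hk => hc.system k (Finset.mem_range.1 hk)
    filter_upwards [hall] with ω hω
    rw [← Finset.sum_range_sub' (fun k => potential N A B mu₀ muN Q k (x k ω)),
      ← Finset.sum_add_distrib]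
    refine Finset.sum_congr rfl fun k hk => ?_
    rw [stageCost_eq hε hric (Finset.mem_range.1 hk), ← hω k hk]
  have i0 := integrable_potential (N := N) (A := A) (B := B) (mu₀ := mu₀) (muN := muN) (Q := Q)
    (hx 0 (Nat.zero_le _)) 0
  have iN := integrable_potential (N := N) (A := A) (B := B) (mu₀ := mu₀) (muN := muN) (Q := Q)
    (hx N le_rfl) N
  rw [integral_congr_ae hae, integral_add (integrable_const _)
      (show Integrable (fun ω => potential N A B mu₀ muN Q 0 (x 0 ω) -
        potential N A B mu₀ muN Q N (x N ω)) P from i0.sub iN), integral_sub i0 iN,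
    integral_const, probReal_univ, one_smul, optimalCost, ← hc.initial,
    integral_map (hc.measurable_state 0 (Nat.zero_le _)).aemeasurable
      (measurable_potential 0).aestronglyMeasurable,
    integral_map (hc.measurable_state N le_rfl).aemeasurable
      (measurable_potential N).aestronglyMeasurable]

theorem EReal.coe_ennreal_eq_zero_of_add_coe_eq {K : ℝ≥0∞} {c : ℝ}
    (h : (K : EReal) + (c : EReal) = (c : EReal)) : K = 0 := by
  induction K with
  | top => rw [EReal.coe_ennreal_top, EReal.top_add_coe] at h; exact absurd h.symm (by simp)
  | coe r =>
    change ((r : ℝ) : EReal) + (c : EReal) = (c : EReal) at h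
    rw [← EReal.coe_add, EReal.coe_eq_coe_iff, add_eq_right] at h
    simpa using h

theorem isUniqueOptimalPolicy_gaussPolicy (hε : 0 < ε) (hG : IsUnit (gramR A B N 0))
    (hric : IsRiccatiSolution N A B Q) (hcov : IsClosedLoopCovariance N A B ε Q Sig) :
    IsUniqueOptimalPolicy N A B ε (multivariateGaussian mu₀ (Sig 0))
      (multivariateGaussian muN (Sig N)) (gaussPolicy N A B ε mu₀ muN Q) := by
  have hpol : IsPolicy N (gaussPolicy N A B ε mu₀ muN Q) := isPolicy_gaussPolicy hε hric
  have hpos : ∀ k < N, ∀ y v, 0 < gaussPolicy N A B ε mu₀ muN Q k y v := fun k hk y v =>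
    gaussDensity_pos (policyCovariance_posDef hε hric hk) _ _
  have hmeanN : meanState N A B mu₀ muN N = muN := by
    rw [meanState_eq_detState, detState_meanInput hG]
  have hfinal : ∀ {Ω : Type} [MeasurableSpace Ω] (P : Measure Ω) [IsProbabilityMeasure P]
      (x : ℕ → Ω → Vec n) (u : ℕ → Ω → Vec m), IsControlled N A B
        (multivariateGaussian mu₀ (Sig 0)) (gaussPolicy N A B ε mu₀ muN Q) P x u →
      P.map (x N) = multivariateGaussian muN (Sig N) ∧
      cost N ε (gaussPolicy N A B ε mu₀ muN Q) P x u =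
        (optimalCost N A B ε mu₀ muN Q (multivariateGaussian mu₀ (Sig 0))
          (multivariateGaussian muN (Sig N)) : EReal) := by
    intro Ω _ P _ x u hc
    have hN : P.map (x N) = multivariateGaussian muN (Sig N) := by
      rw [map_state_eq hε hric hcov hc le_rfl, hmeanN]
    refine ⟨hN, ?_⟩
    rw [cost_eq_relEntropy_add_optimalCost (mu₀ := mu₀) (muN := muN) hε hric hpol hc
      (memLp_two_of_map_eq_gaussian (hc.measurable_state 0 (Nat.zero_le _)) hc.initial)
      (energy_ne_top_of_memLp fun k hk => memLp_input_gaussPolicy hε hric hcov hc hk), hN,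
      Finset.sum_eq_zero, EReal.coe_ennreal_zero, zero_add]
    intro k hk
    simp only [fun y => relEntropy_self (hpos k (Finset.mem_range.1 hk) y), lintegral_zero,
      mul_zero]
  refine ⟨hpol, exists_isControlled hpol, ?_, ?_⟩
  · intro Ω _ P _ x u hc
    obtain ⟨h1, h2⟩ := hfinal P x u hc
    rw [h2]
    exact ⟨h1, EReal.coe_ne_top _, EReal.coe_ne_bot _⟩
  · intro Ω _ P _ x u hc π hπ Ω' _ P' _ x' u' hc' hN'
    rw [(hfinal P x u hc).2]
    by_cases hE : ∑ k ∈ Finset.range N, ∫⁻ ω, ‖u' k ω‖ₑ ^ 2 ∂P' = ⊤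
    · rw [cost, if_pos hE]
      exact ⟨le_top, fun h => absurd h.symm (EReal.coe_ne_top _)⟩
    · have hcost := cost_eq_relEntropy_add_optimalCost (mu₀ := mu₀) (muN := muN) hε hric hπ hc'
        (memLp_two_of_map_eq_gaussian (hc'.measurable_state 0 (Nat.zero_le _)) hc'.initial) hE
      rw [hN'] at hcost
      rw [hcost]
      refine ⟨le_add_of_nonneg_left (EReal.coe_ennreal_nonneg _), fun heq => ?_⟩
      have hsum : ∑ k ∈ Finset.range N, ENNReal.ofReal ε * ∫⁻ ω, relEntropy (π k (x' k ω))
          (gaussPolicy N A B ε mu₀ muN Q k (x' k ω)) ∂P' = 0 :=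
        EReal.coe_ennreal_eq_zero_of_add_coe_eq heq
      -- Vanishing relative entropy gives equality only for the law of the competitor's own state.
      have hae : ∀ k < N, ∀ᵐ y ∂(P'.map (x' k)),
          π k y =ᵐ[volume] gaussPolicy N A B ε mu₀ muN Q k y := by
        intro k hk
        have h1 := (Finset.sum_eq_zero_iff.1 hsum) k (Finset.mem_range.2 hk)
        have h2 := (mul_eq_zero.1 h1).resolve_left (by simpa using hε)
        have hm := measurable_relEntropy (hπ.measurable k hk) (hpol.measurable k hk)
        rw [← lintegral_map (f := fun y => relEntropy (π k y)
          (gaussPolicy N A B ε mu₀ muN Q k y)) hm (hc'.measurable_state k hk.le),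
          lintegral_eq_zero_iff hm] at h2
        filter_upwards [h2] with y hy
        exact eq_ae_of_relEntropy_eq_zero (hπ.measurable_density hk y) (hπ.nonneg k hk y)
          (hpol.measurable_density hk y) (hpos k hk y) hy
      -- By induction that law is the nondegenerate Gaussian with covariance `Sig k`, with respect
      -- to which Lebesgue measure is absolutely continuous.
      have hlaw : ∀ k ≤ N,
          P'.map (x' k) = multivariateGaussian (meanState N A B mu₀ muN k) (Sig k) := by
        intro k
        induction k with
        | zero => intro _; rw [hc'.initial, meanState_eq_detState]; rfl
        | succ k ih =>
          exact fun hk => map_state_succ_eq hε hric hcov hπ hc' hk (ih (by omega)) (hae k hk)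
      intro k hk
      have h := hae k hk
      rw [hlaw k hk.le] at h
      exact (volume_absolutelyContinuous_multivariateGaussian _ (hcov.posDef k hk.le)).ae_le h

end Verification

theorem corollary1 (n m N : ℕ) (hN : 0 < N)
    (A : ℕ → Mat n n) (B : ℕ → Mat n m) (ε : ℝ) (hε : 0 < ε)
    (mu₀ muN : Vec n) (Sig₀ SigN : Mat n n) (hSig₀ : Sig₀.PosDef) (hSigN : SigN.PosDef)
    (hA : ∀ k < N, IsUnit (A k))
    (hG : ∃ kr : ℕ, 1 ≤ kr ∧ kr ≤ N ∧
      (∀ k, kr ≤ k → k ≤ N → IsUnit (gramR A B k 0)) ∧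
      (∀ k, k < kr → IsUnit (gramR A B N k)))
    (hF : IsUnit (calF (S₀ N A B ε Sig₀) (S_N N A B ε SigN)))
    (hB : IsUnit (calB (S₀ N A B ε Sig₀) (S_N N A B ε SigN))) :
    (∀ k ≤ N, IsUnit (Qminus N A B ε Sig₀ SigN k)) ∧
    (∀ k < N, (weight N A B ε Sig₀ SigN k).PosDef) ∧
    IsUniqueMinEnergyInput N A B mu₀ muN (meanInput N A B mu₀ muN) ∧
    (∀ k ≤ N, meanState N A B mu₀ muN k = detState A B mu₀ (meanInput N A B mu₀ muN) k) ∧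
    IsUniqueOptimalPolicy N A B ε (multivariateGaussian mu₀ Sig₀) (multivariateGaussian muN SigN)
      (optPolicy N A B ε mu₀ muN Sig₀ SigN) := by
  obtain ⟨kr, -, hkr, hG', -⟩ := hG
  have hG := hG' N hkr le_rfl
  have hric := isRiccatiSolution_Qminus hε hA hG hSig₀ hSigN hF
  -- The prescribed covariances become the endpoints of the sequence `Sig`. The final terms then
  -- match by unfolding: `optPolicy` is `gaussPolicy` at `Qminus`, and `weight` is the matrix in
  -- `IsRiccatiSolution.posDef`.
  obtain ⟨Sig, rfl, rfl, hcov⟩ := exists_isClosedLoopCovariance hε hA hG hSig₀ hSigN hF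
  exact ⟨hric.isUnit, hric.posDef, isUniqueMinEnergyInput_meanInput hG mu₀ muN,
    fun k _ => meanState_eq_detState mu₀ muN k,
    isUniqueOptimalPolicy_gaussPolicy hε hG hric hcov⟩
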